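/- **Setting.** There are finitely many clients $i=1,\dots,n$ with importances $p_i\ge 0$, $\sum_i p_i=1$, local losses $F_i:\mathbb R^d\to\mathbb R$, and federated loss $F=\sum_i p_iF_i$, bounded below by $F_{\min}$. FedAvg starts at a deterministic $\theta^0$. In round $t$ a client sampling outcome $S_t$ is drawn, giving client $i$ the aggregation weight $\omega_i(S_t)$ (which is $0$ for a client that does not take part). Client $i$ runs $K\ge1$ local SGD steps $\theta^t_{i,0}=\theta^t$, $\theta^t_{i,k+1}=\theta^t_{i,k}-\eta_l\,g_i(\theta^t_{i,k},\xi^t_{i,k})$, and $$\theta^{t+1}=\theta^t+\eta_g\sum_i\omega_i(S_t)\,(\theta^t_{i,K}-\theta^t),\qquad \eta_g,\eta_l>0 .$$ The outcomes $S_t$ are identically distributed, the mini-batches $\xi^t_{i,k}$ have a law $\nu_i$ depending only on the client, and all of these random elements are jointly independent. **Assumptions.** 1. Each $F_i$ is differentiable with $L$-Lipschitz gradient, $L>0$. 2. For every $x$, $\mathbb E_{\xi\sim\nu_i}[g_i(x,\xi)]=\nabla F_i(x)$ and $\mathbb E_{\xi\sim\nu_i}\|g_i(x,\xi)-\nabla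 F_i(x)\|^2\le\sigma^2$. 3. There are $\beta\ge1$ and $\kappa$ such that for all weights $w_i\ge0$ with $\sum_iw_i=1$ and all $x$, $\sum_iw_i\|\nabla F_i(x)\|^2\le\beta^2\|\sum_iw_i\nabla F_i(x)\|^2+\kappa^2$. 4. The weights $\omega_i$ are square-integrable, the sampling is unbiased, $\mathbb E[\omega_i]=p_i$, and there is a real $\alpha$ with $\mathrm{Cov}(\omega_i,\omega_j)=-\alpha p_ip_j$ for all $i\ne j$ and $\mathrm{Var}(\omega_i)+\alpha p_i^2\ge0$ for all $i$ (automatic when $\alpha\ge0$). **Theorem.** There is a constant $C>0$ depending only on $\beta$, and, for any $L,\eta_g>0$, $K\ge 1$ and reals $\alpha, G$, a threshold $\eta_0>0$ depending only on $\beta,L,K,\eta_g,\alpha,G$, such that the following holds whenever $\sum_i\mathrm{Var}(\omega_i)+\alpha\sum_ip_i^2\le G$, $0<\eta_l\le\eta_0$ and $T\ge1$. All $\mathbb E\|\nabla F(\theta^t)\|^2$ are finite, and $$\begin{aligned}\frac1T\sum_{t=0}^{T-1}\mathbb E\|\nabla F(\theta^t)\|^2\le C\Big(&\frac{F(\theta^0)-F_{\min}}{\eta_g\eta_lKT}+L\,\eta_g\eta_l\sum_i\big[\mathrm{Var}(\omega_i)+p_i^2\big]\sigma^2+L^2\eta_l^2(K-1)\sigma^2+L^2\eta_l^2K(K-1)\kappa^2\\&+L\,\eta_g\eta_l\Big(\sum_i\mathrm{Var}(\omega_i)+\alpha\sum_ip_i^2\Big)\big[(K-1)\sigma^2+K\kappa^2\big]\Big).\end{aligned}$$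 Under full participation ($\omega_i=p_i$ almost surely for all $i$, $\alpha=0$) with $\eta_g=1$, the bound becomes FedNova's rate: $$\frac1T\sum_{t=0}^{T-1}\mathbb E\|\nabla F(\theta^t)\|^2\le C\Big(\frac{F(\theta^0)-F_{\min}}{\eta_lKT}+L\,\eta_l\sum_ip_i^2\,\sigma^2+L^2\eta_l^2(K-1)\sigma^2+L^2\eta_l^2K(K-1)\kappa^2\Big),$$ and if moreover $\eta_l=\sqrt{n/(KT)}$ (still $\le\eta_0$), then $$\frac1T\sum_{t=0}^{T-1}\mathbb E\|\nabla F(\theta^t)\|^2\le C\Big(\frac{F(\theta^0)-F_{\min}}{\sqrt{nKT}}+L\sqrt{\tfrac{n}{KT}}\sum_ip_i^2\,\sigma^2+L^2\tfrac nT\sigma^2+L^2\tfrac nTK\kappa^2\Big).$$ -/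

import Mathlib

open MeasureTheory ProbabilityTheory

namespace FedAvg

/-- The model parameters live in `ℝ^d` with its Euclidean norm. -/
abbrev Param (d : ℕ) : Type := EuclideanSpace ℝ (Fin d)

/-- `localIterate g ηl θ ξ k`: the local model of a client after `k` vanilla SGD steps started at
the global model `θ`, with stochastic gradient `g`, step size `ηl` and mini-batches `ξ 0, ξ 1, …`. -/
def localIterate {d : ℕ} {Ξ : Type*} (g : Param d → Ξ → Param d) (ηl : ℝ) (θ : Param d)
    (ξ : ℕ → Ξ) : ℕ → Param d
  | 0 => θ
  | k + 1 => localIterate g ηl θ ξ k - ηl • g (localIterate g ηl θ ξ k) (ξ k)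

/-- `globalIterate … t`: the global model after `t` rounds of FedAvg. In round `t` the outcome `S t`
of the client sampling gives client `i` the aggregation weight `ω (S t) i` (the weight is `0` for a
client that does not take part), each participant runs `K` local SGD steps from the current global
model `θ`, and the new global model is `θ + ηg ∑ i, ω (S t) i (θ_i - θ)`. -/
noncomputable def globalIterate {d : ℕ} {ι 𝒮 Ξ : Type*} [Fintype ι]
    (g : ι → Param d → Ξ → Param d) (ω : 𝒮 → ι → ℝ) (ηg ηl : ℝ) (K : ℕ) (θ₀ : Param d)
    (S : ℕ → 𝒮) (ξ : ℕ → ι → ℕ → Ξ) : ℕ → Param d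
  | 0 => θ₀
  | t + 1 =>
    globalIterate g ω ηg ηl K θ₀ S ξ t + ηg • ∑ i, ω (S t) i •
      (localIterate (g i) ηl (globalIterate g ω ηg ηl K θ₀ S ξ t) (ξ t i) K
        - globalIterate g ω ηg ηl K θ₀ S ξ t)

/-- The federated objective `∑ i, p i * F i`. -/
def globalLoss {d : ℕ} {ι : Type*} [Fintype ι] (p : ι → ℝ) (F : ι → Param d → ℝ) (x : Param d) :
    ℝ :=
  ∑ i, p i * F i x

/-- `L`-smoothness: differentiable, with `L`-Lipschitz gradient. -/
structure IsSmoothLoss {d : ℕ} (L : ℝ) (f : Param d → ℝ) : Prop where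
  differentiable : Differentiable ℝ f
  lipschitz : ∀ x y, ‖gradient f x - gradient f y‖ ≤ L * ‖x - y‖

/-- For a mini-batch of law `ν`, `g x` is an unbiased estimator of the gradient of `f` at `x`, with
variance at most `σ ^ 2`. -/
structure IsStochasticGradient {d : ℕ} {Ξ : Type*} [MeasurableSpace Ξ] (ν : Measure Ξ) (σ : ℝ)
    (f : Param d → ℝ) (g : Param d → Ξ → Param d) : Prop where
  measurable : Measurable (Function.uncurry g)
  integrable : ∀ x, Integrable (g x) ν
  unbiased : ∀ x, ∫ z, g x z ∂ν = gradient f x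
  sq_integrable : ∀ x, Integrable (fun z => ‖g x z - gradient f x‖ ^ 2) ν
  variance_le : ∀ x, ∫ z, ‖g x z - gradient f x‖ ^ 2 ∂ν ≤ σ ^ 2

/-- Bounded dissimilarity of the local gradients, for every convex combination of the clients. -/
def BoundedDissimilarity {d : ℕ} {ι : Type*} [Fintype ι] (β κ : ℝ) (F : ι → Param d → ℝ) : Prop :=
  ∀ w : ι → ℝ, (∀ i, 0 ≤ w i) → ∑ i, w i = 1 → ∀ x,
    ∑ i, w i * ‖gradient (F i) x‖ ^ 2 ≤ β ^ 2 * ‖∑ i, w i • gradient (F i) x‖ ^ 2 + κ ^ 2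

/-- `ρ` is the law of the sampling outcome of one round. The aggregation weights are unbiased,
`E[ω_i] = p_i`, and have the covariance structure `Cov(ω_i, ω_j) = - α p_i p_j` for `i ≠ j`. -/
structure IsUnbiasedSampling {ι 𝒮 : Type*} [MeasurableSpace 𝒮] (ρ : Measure 𝒮)
    (ω : 𝒮 → ι → ℝ) (p : ι → ℝ) (α : ℝ) : Prop where
  measurable : ∀ i, Measurable (fun s => ω s i)
  memLp : ∀ i, MemLp (fun s => ω s i) 2 ρ
  unbiased : ∀ i, ∫ s, ω s i ∂ρ = p i
  covariance : ∀ i j, i ≠ j → covariance (fun s => ω s i) (fun s => ω s j) ρ = -α * p i * p j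

/-- `∑ i, Var(ω_i)`. -/
noncomputable def sumVar {ι 𝒮 : Type*} [Fintype ι] [MeasurableSpace 𝒮] (ρ : Measure 𝒮)
    (ω : 𝒮 → ι → ℝ) : ℝ :=
  ∑ i, variance (fun s => ω s i) ρ

/-- The sampling outcomes `S t` (round `t`) have law `ρ`, the mini-batches `ξ t i k` (round `t`,
client `i`, local step `k`) have law `ν i`, and all of them are jointly independent. -/
structure IsFedAvgRandomness {Ω ι 𝒮 Ξ : Type*} [MeasurableSpace Ω] [MeasurableSpace 𝒮]
    [MeasurableSpace Ξ] (μ : Measure Ω) (ρ : Measure 𝒮) (ν : ι → Measure Ξ)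
    (S : ℕ → Ω → 𝒮) (ξ : ℕ → ι → ℕ → Ω → Ξ) : Prop where
  measurable_sampling : ∀ t, Measurable (S t)
  measurable_batch : ∀ t i k, Measurable (ξ t i k)
  law_sampling : ∀ t, μ.map (S t) = ρ
  law_batch : ∀ t i k, μ.map (ξ t i k) = ν i
  indep : iIndep (Sum.elim
    (fun t : ℕ => MeasurableSpace.comap (S t) inferInstance)
    (fun q : ℕ × ι × ℕ => MeasurableSpace.comap (ξ q.1 q.2.1 q.2.2) inferInstance)) μ

/-- The average over the rounds `t < T` of `E ‖∇f(θ t)‖ ^ 2`. -/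
noncomputable def avgSqGrad {d : ℕ} {Ω : Type*} [MeasurableSpace Ω] (μ : Measure Ω)
    (f : Param d → ℝ) (θ : ℕ → Ω → Param d) (T : ℕ) : ℝ :=
  1 / (T : ℝ) * ∑ t ∈ Finset.range T, ∫ a, ‖gradient f (θ t a)‖ ^ 2 ∂μ

end FedAvg

/-! Fix a round and its starting model `x`. Let `U i` be the sum of the `K` stochastic gradients of
client `i`, and `U = ∑ i, ω i • U i`; the server moves by `-(ηg * ηl) • U`. By the descent lemma the
expected loss changes by at most `-ηg ηl ⟨∇F x, E U⟩ + (L/2) ηg² ηl² E‖U‖²`, so one needs the mean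
and the second moment of `U`.

Mean: the weights are independent of the mini-batches, so `E U = ∑ p i • m i` with `m i = E (U i)`.
The noise averages out, and `m i` differs from `K ∇F i x` only through the client drift, which
smoothness controls (`sum_integral_norm_sq_localIterate_sub_le`).

Second moment: expanding the square and using independence of distinct clients
(`integral_norm_sq_aggregation`), `E‖U‖² = (1 - α) ‖∑ p i • m i‖² + ∑ E[ω i ²] Var(U i) + ∑ (Var(ω
i) + α p i ²) ‖m i‖²`. The three sums give the gradient, the noise and the heterogeneity
contribution.

The last sum and the drift involve individual gradients `∇F i x`. Dissimilarity is assumed for every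
convex combination, so it can be applied to `p` tilted slightly towards client `i`; this bounds `‖∇F
i x‖²` by a multiple of `‖∇F x‖²` plus a multiple of `κ²`
(`BoundedDissimilarity.norm_sq_gradient_le`). For small `ηl` every such multiple of `‖∇F x‖²` is
absorbed by half of the descent term (`descent_arith`).

Finally, the model at round `t` is independent of the randomness of round `t`, so the fixed-model
inequality integrates along the trajectory, and the losses telescope (`avgSqGrad_le`). -/

namespace FedAvg

/-! ### Smoothness, convexity inequalities and gradient dissimilarity. -/

section Losses

variable {d : ℕ} {ι : Type*}

theorem IsSmoothLoss.hasGradientAt {L : ℝ} {f : Param d → ℝ} (hf : IsSmoothLoss L f)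
    (x : Param d) : HasGradientAt f (gradient f x) x :=
  (hf.differentiable x).hasGradientAt

theorem IsSmoothLoss.continuous_gradient {L : ℝ} {f : Param d → ℝ} (hf : IsSmoothLoss L f) :
    Continuous (gradient f) :=
  (LipschitzWith.of_dist_le_mul (K := L.toNNReal) fun x y => by
    rw [dist_eq_norm, dist_eq_norm]
    exact (hf.lipschitz x y).trans
      (mul_le_mul_of_nonneg_right (Real.le_coe_toNNReal L) (norm_nonneg _))).continuous

/-- The descent lemma. -/
theorem IsSmoothLoss.le_quadratic {L : ℝ} {f : Param d → ℝ} (hf : IsSmoothLoss L f)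
    (x v : Param d) :
    f (x + v) ≤ f x + inner ℝ (gradient f x) v + L / 2 * ‖v‖ ^ 2 := by
  have hline : ∀ s : ℝ, HasDerivAt (fun s : ℝ => x + s • v) v s := fun s => by
    simpa using ((hasDerivAt_id s).smul_const v).const_add x
  have hder : ∀ s : ℝ, HasDerivAt
      (fun s : ℝ => f (x + s • v) - s * inner ℝ (gradient f x) v - L / 2 * ‖v‖ ^ 2 * s ^ 2)
      (inner ℝ (gradient f (x + s • v)) v - inner ℝ (gradient f x) v - L * ‖v‖ ^ 2 * s) s := by
    intro s
    have h1 := (hf.hasGradientAt (x + s • v)).hasFDerivAt.comp_hasDerivAt s (hline s)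
    have h2 := (hasDerivAt_id s).mul_const (inner ℝ (gradient f x) v)
    have h3 := ((hasDerivAt_id s).pow 2).const_mul (L / 2 * ‖v‖ ^ 2)
    refine ((h1.sub h2).sub h3).congr_deriv ?_
    simp
    ring
  -- The Lipschitz bound makes the gap between `f` on the segment and its quadratic majorant
  -- nonincreasing; compare `s = 0` with `s = 1`.
  have hanti : AntitoneOn
      (fun s : ℝ => f (x + s • v) - s * inner ℝ (gradient f x) v - L / 2 * ‖v‖ ^ 2 * s ^ 2)
      (Set.Icc 0 1) := by
    refine antitoneOn_of_deriv_nonpos (convex_Icc 0 1)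
      (fun s _ => (hder s).continuousAt.continuousWithinAt)
      (fun s _ => (hder s).differentiableAt.differentiableWithinAt) fun s hs => ?_
    rw [(hder s).deriv, ← inner_sub_left]
    rw [interior_Icc] at hs
    have h1 := real_inner_le_norm (gradient f (x + s • v) - gradient f x) v
    have h2 := hf.lipschitz (x + s • v) x
    rw [add_sub_cancel_left, norm_smul, Real.norm_of_nonneg hs.1.le] at h2
    nlinarith [mul_le_mul_of_nonneg_right h2 (norm_nonneg v)]
  have := hanti (Set.left_mem_Icc.2 zero_le_one) (Set.right_mem_Icc.2 zero_le_one) zero_le_one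
  simp only [one_smul, zero_smul, add_zero] at this
  linarith

section Convexity

variable {E : Type*} [NormedAddCommGroup E] [InnerProductSpace ℝ E]

theorem norm_sq_add_le (a b : E) : ‖a + b‖ ^ 2 ≤ 2 * ‖a‖ ^ 2 + 2 * ‖b‖ ^ 2 := by
  nlinarith [parallelogram_law_with_norm ℝ a b, sq_nonneg ‖a - b‖, sq_nonneg ‖a + b‖]

omit [InnerProductSpace ℝ E] in
theorem norm_sq_sum_le (s : Finset ι) (v : ι → E) :
    ‖∑ i ∈ s, v i‖ ^ 2 ≤ s.card * ∑ i ∈ s, ‖v i‖ ^ 2 :=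
  (pow_le_pow_left₀ (norm_nonneg _) (norm_sum_le s v) 2).trans sq_sum_le_card_mul_sum_sq

theorem norm_sq_convex_sum_le [Fintype ι] {p : ι → ℝ} (hp : ∀ i, 0 ≤ p i) (hp1 : ∑ i, p i = 1)
    (v : ι → E) : ‖∑ i, p i • v i‖ ^ 2 ≤ ∑ i, p i * ‖v i‖ ^ 2 := by
  have h1 : ‖∑ i, p i • v i‖ ≤ ∑ i, p i * ‖v i‖ :=
    (norm_sum_le _ _).trans_eq (Finset.sum_congr rfl fun i _ => by
      rw [norm_smul, Real.norm_of_nonneg (hp i)])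
  exact (pow_le_pow_left₀ (norm_nonneg _) h1 2).trans
    (Real.pow_arith_mean_le_arith_mean_pow _ p _ (fun i _ => hp i) hp1
      (fun i _ => norm_nonneg _) 2)

end Convexity

variable [Fintype ι] {p : ι → ℝ} {F : ι → Param d → ℝ} {L β κ : ℝ}

theorem hasGradientAt_globalLoss (hF : ∀ i, IsSmoothLoss L (F i)) (x : Param d) :
    HasGradientAt (globalLoss p F) (∑ i, p i • gradient (F i) x) x := by
  rw [hasGradientAt_iff_hasFDerivAt, map_sum]
  have h := HasFDerivAt.fun_sum (u := Finset.univ) fun i _ =>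
    ((hF i).hasGradientAt x).hasFDerivAt.const_mul (p i)
  refine h.congr_fderiv (Finset.sum_congr rfl fun i _ => ?_)
  rw [map_smulₛₗ]
  simp

theorem gradient_globalLoss (hF : ∀ i, IsSmoothLoss L (F i)) (x : Param d) :
    gradient (globalLoss p F) x = ∑ i, p i • gradient (F i) x :=
  (hasGradientAt_globalLoss hF x).gradient

theorem isSmoothLoss_globalLoss (hp : ∀ i, 0 ≤ p i) (hp1 : ∑ i, p i = 1)
    (hF : ∀ i, IsSmoothLoss L (F i)) : IsSmoothLoss L (globalLoss p F) where
  differentiable x := (hasGradientAt_globalLoss hF x).differentiableAt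
  lipschitz x y := by
    rw [gradient_globalLoss hF, gradient_globalLoss hF, ← Finset.sum_sub_distrib]
    calc ‖∑ i, (p i • gradient (F i) x - p i • gradient (F i) y)‖
        ≤ ∑ i, p i * (L * ‖x - y‖) := norm_sum_le_of_le _ fun i _ => by
          rw [← smul_sub, norm_smul, Real.norm_of_nonneg (hp i)]
          exact mul_le_mul_of_nonneg_left ((hF i).lipschitz x y) (hp i)
      _ = L * ‖x - y‖ := by rw [← Finset.sum_mul, hp1, one_mul]

/-- Bounded dissimilarity for all convex combinations controls each local gradient by the gradient
of any fixed convex combination. -/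
theorem BoundedDissimilarity.norm_sq_gradient_le (h : BoundedDissimilarity β κ F) (hβ : 1 ≤ β)
    (hp : ∀ i, 0 ≤ p i) (hp1 : ∑ i, p i = 1) (x : Param d) (i : ι) :
    ‖gradient (F i) x‖ ^ 2 ≤
      16 * β ^ 4 * ‖∑ j, p j • gradient (F j) x‖ ^ 2 + 8 * β ^ 2 * κ ^ 2 := by
  classical
  set a := fun j => gradient (F j) x
  set abar := ∑ j, p j • a j with habar
  -- Weights: `p` tilted by `c` towards client `i`. Dissimilarity puts `c ‖a i‖²` on the left and `2
  -- β² c² ‖a i‖²` on the right; this `c` makes the latter half of the former.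
  set c : ℝ := 1 / (4 * β ^ 2) with hc
  have hβ2 : 1 ≤ β ^ 2 := one_le_pow₀ hβ
  have hc0 : 0 < c := by positivity
  have hc1 : c ≤ 1 := by
    rw [hc, div_le_one (by positivity)]; linarith
  have hcβ : c * (4 * β ^ 2) = 1 := by rw [hc]; field_simp
  have key := h (fun j => c * (if j = i then 1 else 0) + (1 - c) * p j)
    (fun j => add_nonneg (mul_nonneg hc0.le (by split_ifs <;> norm_num))
      (mul_nonneg (by linarith) (hp j)))
    (by rw [Finset.sum_add_distrib, ← Finset.mul_sum, ← Finset.mul_sum, hp1]; simp) x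
  have hL : ∑ j, (c * (if j = i then 1 else 0) + (1 - c) * p j) * ‖gradient (F j) x‖ ^ 2
      = c * ‖a i‖ ^ 2 + (1 - c) * ∑ j, p j * ‖a j‖ ^ 2 := by
    simp only [add_mul, Finset.sum_add_distrib, Finset.mul_sum, mul_assoc, a]
    simp
  have hR : ∑ j, (c * (if j = i then 1 else 0) + (1 - c) * p j) • gradient (F j) x
      = c • a i + (1 - c) • abar := by
    simp only [add_smul, Finset.sum_add_distrib, habar, Finset.smul_sum, mul_smul, a]
    simp
  rw [hL, hR] at key
  have h1 : 0 ≤ (1 - c) * ∑ j, p j * ‖a j‖ ^ 2 :=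
    mul_nonneg (by linarith) (Finset.sum_nonneg fun j _ => mul_nonneg (hp j) (sq_nonneg _))
  have h2 := norm_sq_add_le (c • a i) ((1 - c) • abar)
  rw [norm_smul, norm_smul, Real.norm_of_nonneg hc0.le, Real.norm_of_nonneg (by linarith),
    mul_pow, mul_pow] at h2
  have h3 : (1 - c) ^ 2 * ‖abar‖ ^ 2 ≤ ‖abar‖ ^ 2 :=
    mul_le_of_le_one_left (sq_nonneg _) (pow_le_one₀ (by linarith) (by linarith))
  have h4 : c * ‖a i‖ ^ 2 ≤ β ^ 2 * (2 * (c ^ 2 * ‖a i‖ ^ 2) + 2 * ‖abar‖ ^ 2) + κ ^ 2 := by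
    nlinarith [mul_le_mul_of_nonneg_left h2 (sq_nonneg β),
      mul_le_mul_of_nonneg_left h3 (sq_nonneg β)]
  have h5 : β ^ 2 * (2 * (c ^ 2 * ‖a i‖ ^ 2)) = c / 2 * ‖a i‖ ^ 2 := by
    linear_combination (c * ‖a i‖ ^ 2 / 2) * hcβ
  have h6 : c / 2 * ‖a i‖ ^ 2 ≤ 2 * β ^ 2 * ‖abar‖ ^ 2 + κ ^ 2 := by nlinarith
  have h7 := mul_le_mul_of_nonneg_left h6 (show (0 : ℝ) ≤ 8 * β ^ 2 by positivity)
  have h8 : 8 * β ^ 2 * (c / 2 * ‖a i‖ ^ 2) = ‖a i‖ ^ 2 := by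
    linear_combination ‖a i‖ ^ 2 * hcβ
  rw [h8] at h7
  change ‖a i‖ ^ 2 ≤ _
  linarith

end Losses

/-! ### Integrating out an independent variable. -/

section Independence

variable {Ω 𝒳 𝒵 : Type*} {mΩ : MeasurableSpace Ω} [MeasurableSpace 𝒳] [MeasurableSpace 𝒵]
  {μ : Measure Ω} [IsProbabilityMeasure μ]

/-- Tonelli on the product law. It asks for no integrability, so it can serve to establish square
integrability of noise and iterates. -/
theorem lintegral_indepFun_eq {X : Ω → 𝒳} {Z : Ω → 𝒵} (hX : Measurable X) (hZ : Measurable Z)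
    (h : IndepFun X Z μ) {f : 𝒳 → 𝒵 → ENNReal} (hf : Measurable (Function.uncurry f)) :
    ∫⁻ a, f (X a) (Z a) ∂μ = ∫⁻ a, ∫⁻ z, f (X a) z ∂(μ.map Z) ∂μ := by
  have := Measure.isProbabilityMeasure_map (μ := μ) hZ.aemeasurable
  have h1 := lintegral_map (μ := μ) hf (hX.prodMk hZ)
  rw [h.map_prod_eq_prod_map_map hX.aemeasurable hZ.aemeasurable,
    lintegral_prod _ hf.aemeasurable] at h1
  simp only [Function.uncurry] at h1
  rw [← h1]
  exact lintegral_map (f := fun x => ∫⁻ z, f x z ∂(μ.map Z)) hf.lintegral_prod_right' hX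

theorem integral_indepFun_eq {X : Ω → 𝒳} {Z : Ω → 𝒵} (hX : Measurable X) (hZ : Measurable Z)
    (h : IndepFun X Z μ) {f : 𝒳 → 𝒵 → ℝ} (hf : Measurable (Function.uncurry f))
    (hint : Integrable (fun a => f (X a) (Z a)) μ) :
    ∫ a, f (X a) (Z a) ∂μ = ∫ a, ∫ z, f (X a) z ∂(μ.map Z) ∂μ := by
  have := Measure.isProbabilityMeasure_map (μ := μ) hZ.aemeasurable
  have h1 := integral_map (μ := μ) (hX.prodMk hZ).aemeasurable
    hf.stronglyMeasurable.aestronglyMeasurable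
  have h2 := (integrable_map_measure (μ := μ) hf.stronglyMeasurable.aestronglyMeasurable
    (hX.prodMk hZ).aemeasurable).2 hint
  rw [h.map_prod_eq_prod_map_map hX.aemeasurable hZ.aemeasurable] at h1 h2
  rw [integral_prod _ h2] at h1
  simp only [Function.uncurry] at h1
  rw [← h1]
  exact integral_map hX.aemeasurable
    (f := fun x => ∫ z, f x z ∂(μ.map Z))
    hf.stronglyMeasurable.integral_prod_right'.aestronglyMeasurable

omit [IsProbabilityMeasure μ] in
theorem integrable_of_lintegral_le {f : Ω → ℝ} (hf : AEStronglyMeasurable f μ) (h0 : ∀ a, 0 ≤ f a)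
    {c : ℝ} (h : ∫⁻ a, ENNReal.ofReal (f a) ∂μ ≤ ENNReal.ofReal c) : Integrable f μ :=
  ⟨hf, by
    rw [hasFiniteIntegral_iff_ofReal (Filter.Eventually.of_forall h0)]
    exact h.trans_lt ENNReal.ofReal_lt_top⟩

omit [IsProbabilityMeasure μ] in
theorem integral_le_of_lintegral_le {f : Ω → ℝ} (hf : AEStronglyMeasurable f μ)
    (h0 : ∀ a, 0 ≤ f a) {c : ℝ} (hc : 0 ≤ c)
    (h : ∫⁻ a, ENNReal.ofReal (f a) ∂μ ≤ ENNReal.ofReal c) : ∫ a, f a ∂μ ≤ c := by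
  rw [integral_eq_lintegral_of_nonneg_ae (Filter.Eventually.of_forall h0) hf]
  exact ENNReal.toReal_le_of_le_ofReal hc h

end Independence

/-! ### Bias-variance identities for square-integrable vectors. -/

section SquareIntegrable

variable {Ω E : Type*} {mΩ : MeasurableSpace Ω} {μ : Measure Ω}
  [NormedAddCommGroup E]

theorem integrable_norm_sq {X : Ω → E} (hX : MemLp X 2 μ) : Integrable (fun a => ‖X a‖ ^ 2) μ :=
  (memLp_two_iff_integrable_sq_norm hX.1).1 hX

theorem memLp_two_of_norm_sq_le {X : Ω → E} (hX : AEStronglyMeasurable X μ) {f : Ω → ℝ}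
    (hf : Integrable f μ) (h : ∀ a, ‖X a‖ ^ 2 ≤ f a) : MemLp X 2 μ :=
  (memLp_two_iff_integrable_sq_norm hX).2 <| hf.mono' (hX.norm.pow 2) <|
    Filter.Eventually.of_forall fun a => by
      rw [Real.norm_of_nonneg (sq_nonneg _)]; exact h a

variable [InnerProductSpace ℝ E]

theorem integrable_inner {X Y : Ω → E} (hX : MemLp X 2 μ) (hY : MemLp Y 2 μ) :
    Integrable (fun a => inner ℝ (X a) (Y a)) μ :=
  ((integrable_norm_sq hX).add (integrable_norm_sq hY)).mono' (hX.1.inner hY.1) <|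
    Filter.Eventually.of_forall fun a => by
      have := norm_inner_le_norm (𝕜 := ℝ) (X a) (Y a)
      simp only [Pi.add_apply]
      nlinarith [sq_nonneg (‖X a‖ - ‖Y a‖), norm_nonneg (X a), norm_nonneg (Y a)]

variable [CompleteSpace E] [IsProbabilityMeasure μ]

theorem integral_norm_sub_sq {X : Ω → E} (hX : MemLp X 2 μ) (c : E) :
    ∫ a, ‖X a - c‖ ^ 2 ∂μ = ∫ a, ‖X a‖ ^ 2 ∂μ - 2 * inner ℝ (∫ a, X a ∂μ) c + ‖c‖ ^ 2 := by
  have hi := hX.integrable one_le_two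
  have h : ∀ a, ‖X a - c‖ ^ 2 = ‖X a‖ ^ 2 - 2 * inner ℝ c (X a) + ‖c‖ ^ 2 := fun a => by
    rw [norm_sub_sq_real, real_inner_comm]
  simp only [h]
  rw [integral_add (f := fun a => ‖X a‖ ^ 2 - 2 * inner ℝ c (X a))
    ((integrable_norm_sq hX).sub ((hi.const_inner c).const_mul 2))
    (integrable_const _), integral_sub (integrable_norm_sq hX) ((hi.const_inner c).const_mul 2),
    integral_const_mul, integral_inner hi, real_inner_comm]
  simp

theorem norm_sq_integral_sub_le {X : Ω → E} (hX : MemLp X 2 μ) (c : E) :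
    ‖∫ a, X a ∂μ - c‖ ^ 2 ≤ ∫ a, ‖X a - c‖ ^ 2 ∂μ := by
  have h1 := integral_norm_sub_sq hX c
  have h2 := integral_norm_sub_sq hX (∫ a, X a ∂μ)
  have h3 : 0 ≤ ∫ a, ‖X a - ∫ a, X a ∂μ‖ ^ 2 ∂μ := integral_nonneg fun a => sq_nonneg _
  rw [real_inner_self_eq_norm_sq] at h2
  rw [norm_sub_sq_real]
  linarith

/-- The variance of a random vector is at most its mean square distance to any point. -/
theorem integral_norm_sq_sub_le {X : Ω → E} (hX : MemLp X 2 μ) (c : E) :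
    ∫ a, ‖X a‖ ^ 2 ∂μ - ‖∫ a, X a ∂μ‖ ^ 2 ≤ ∫ a, ‖X a - c‖ ^ 2 ∂μ := by
  have h1 := integral_norm_sub_sq hX c
  have h2 := sq_nonneg ‖∫ a, X a ∂μ - c‖
  rw [norm_sub_sq_real] at h2
  linarith

end SquareIntegrable

/-! ### Local SGD from a fixed model: the noise as martingale differences. -/

section LocalSGD

variable {d : ℕ} {Ω Ξ : Type*} {m mΩ : MeasurableSpace Ω} [MeasurableSpace Ξ]
  {μ : Measure Ω} [IsProbabilityMeasure μ] {ν : Measure Ξ} {L σ : ℝ} {f : Param d → ℝ}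
  {g : Param d → Ξ → Param d}

omit [IsProbabilityMeasure μ] in
theorem indepFun_of_measurable {𝒳 𝒵 : Type*} [MeasurableSpace 𝒳] [MeasurableSpace 𝒵]
    {m₁ m₂ : MeasurableSpace Ω} {X : Ω → 𝒳} {Z : Ω → 𝒵} (h : Indep m₁ m₂ μ)
    (hX : Measurable[m₁] X) (hZ : Measurable[m₂] Z) : IndepFun X Z μ := by
  rw [IndepFun_iff_Indep]
  exact indep_of_indep_of_le_left (indep_of_indep_of_le_right h hZ.comap_le) hX.comap_le

section Noise

variable {X : Ω → Param d} {Z : Ω → Ξ} (hg : IsStochasticGradient ν σ f g)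
  (hf : IsSmoothLoss L f) (hm : m ≤ mΩ) (hX : Measurable[m] X) (hZ : Measurable Z)
  (hlaw : μ.map Z = ν) (hind : Indep m (MeasurableSpace.comap Z inferInstance) μ)

include hg hf in
theorem IsStochasticGradient.measurable_noise :
    Measurable (fun q : Param d × Ξ => g q.1 q.2 - gradient f q.1) :=
  hg.measurable.sub (hf.continuous_gradient.measurable.comp measurable_fst)

include hg hf hm hX hZ hlaw hind in
theorem IsStochasticGradient.lintegral_noise_le :
    ∫⁻ a, ENNReal.ofReal (‖g (X a) (Z a) - gradient f (X a)‖ ^ 2) ∂μ ≤ ENNReal.ofReal (σ ^ 2) := by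
  have hXZ := indepFun_of_measurable hind hX (comap_measurable Z)
  rw [lintegral_indepFun_eq (hX.mono hm le_rfl) hZ hXZ
    (f := fun x z => ENNReal.ofReal (‖g x z - gradient f x‖ ^ 2))
    ((hg.measurable_noise hf).norm.pow_const 2).ennreal_ofReal, hlaw]
  calc ∫⁻ a, ∫⁻ z, ENNReal.ofReal (‖g (X a) z - gradient f (X a)‖ ^ 2) ∂ν ∂μ
      ≤ ∫⁻ _, ENNReal.ofReal (σ ^ 2) ∂μ := lintegral_mono fun a => by
        rw [← ofReal_integral_eq_lintegral_ofReal (hg.sq_integrable (X a))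
          (Filter.Eventually.of_forall fun _ => sq_nonneg _)]
        exact ENNReal.ofReal_le_ofReal (hg.variance_le _)
    _ = ENNReal.ofReal (σ ^ 2) := by simp

include hg hf hm hX hZ in
theorem IsStochasticGradient.measurable_noise_comp :
    Measurable (fun a => g (X a) (Z a) - gradient f (X a)) :=
  (hg.measurable_noise hf).comp ((hX.mono hm le_rfl).prodMk hZ)

include hg hf hm hX hZ hlaw hind in
theorem IsStochasticGradient.memLp_noise :
    MemLp (fun a => g (X a) (Z a) - gradient f (X a)) 2 μ := by
  have h1 := (hg.measurable_noise_comp hf hm hX hZ).aestronglyMeasurable (μ := μ)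
  exact (memLp_two_iff_integrable_sq_norm h1).2 <| integrable_of_lintegral_le (h1.norm.pow 2)
    (fun _ => sq_nonneg _) (hg.lintegral_noise_le hf hm hX hZ hlaw hind)

include hg hf hm hX hZ hlaw hind in
theorem IsStochasticGradient.integral_norm_sq_noise_le :
    ∫ a, ‖g (X a) (Z a) - gradient f (X a)‖ ^ 2 ∂μ ≤ σ ^ 2 :=
  integral_le_of_lintegral_le
    ((hg.measurable_noise_comp hf hm hX hZ).aestronglyMeasurable.norm.pow 2)
    (fun _ => sq_nonneg _) (sq_nonneg σ) (hg.lintegral_noise_le hf hm hX hZ hlaw hind)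

include hg hf hm hX hZ hlaw hind in
-- The pair `(W, X)` is determined by the past `m` and the batch `Z` is independent of it, so with
-- the pair frozen the noise has mean zero. This is the orthogonality behind all later variance
-- bounds.
theorem IsStochasticGradient.integral_inner_noise {W : Ω → Param d} (hW : Measurable[m] W)
    (hW2 : MemLp W 2 μ) : ∫ a, inner ℝ (W a) (g (X a) (Z a) - gradient f (X a)) ∂μ = 0 := by
  have hWX : Measurable[m] (fun a => (W a, X a)) := hW.prodMk hX
  have hXZ := indepFun_of_measurable hind hWX (comap_measurable Z)
  have hmeas : Measurable (Function.uncurry fun (u : Param d × Param d) (z : Ξ) =>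
      inner ℝ u.1 (g u.2 z - gradient f u.2)) :=
    (measurable_fst.comp measurable_fst).inner
      ((hg.measurable_noise hf).comp ((measurable_snd.comp measurable_fst).prodMk measurable_snd))
  have hν : IsProbabilityMeasure ν := hlaw ▸ Measure.isProbabilityMeasure_map hZ.aemeasurable
  rw [integral_indepFun_eq (hWX.mono hm le_rfl) hZ hXZ hmeas
    (integrable_inner hW2 (hg.memLp_noise hf hm hX hZ hlaw hind)), hlaw]
  refine integral_eq_zero_of_ae (Filter.Eventually.of_forall fun a => ?_)
  change ∫ z, inner ℝ (W a) (g (X a) z - gradient f (X a)) ∂ν = 0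
  rw [integral_inner (f := fun z => g (X a) z - gradient f (X a))
      ((hg.integrable _).sub (integrable_const _)),
    integral_sub (hg.integrable _) (integrable_const _), hg.unbiased]
  simp

end Noise

/-- The mini-batches `ξ k` have law `ν`, are adapted to `𝓕 (k + 1)` and independent of `𝓕 k`. -/
structure IsAdaptedBatches (μ : Measure Ω) (ν : Measure Ξ) (𝓕 : ℕ → MeasurableSpace Ω)
    (ξ : ℕ → Ω → Ξ) : Prop where
  le : ∀ k, 𝓕 k ≤ mΩ
  mono : Monotone 𝓕
  adapted : ∀ k, Measurable[𝓕 (k + 1)] (ξ k)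
  law : ∀ k, μ.map (ξ k) = ν
  indep : ∀ k, Indep (𝓕 k) (MeasurableSpace.comap (ξ k) inferInstance) μ

/-- The stochastic noise of the local step `k`. -/
noncomputable def localNoise (f : Param d → ℝ) (g : Param d → Ξ → Param d) (ηl : ℝ) (x : Param d)
    (ξ : ℕ → Ξ) (k : ℕ) : Param d :=
  g (localIterate g ηl x ξ k) (ξ k) - gradient f (localIterate g ηl x ξ k)

omit [MeasurableSpace Ξ] in
-- Separates the martingale part, whose square grows linearly in `k`, from the gradient part, which
-- is handled by smoothness.
theorem localIterate_eq (f : Param d → ℝ) (g : Param d → Ξ → Param d) (ηl : ℝ) (x : Param d)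
    (ξ : ℕ → Ξ) (k : ℕ) :
    localIterate g ηl x ξ k = x - ηl • (∑ j ∈ Finset.range k, localNoise f g ηl x ξ j +
      ∑ j ∈ Finset.range k, gradient f (localIterate g ηl x ξ j)) := by
  induction k with
  | zero => simp [localIterate]
  | succ k ih =>
    rw [Finset.sum_range_succ, Finset.sum_range_succ, localIterate]
    nth_rw 1 [ih]
    rw [localNoise]
    simp only [smul_add, smul_sub]
    abel

variable {ηl : ℝ} {x : Param d} {𝓕 : ℕ → MeasurableSpace Ω} {ξ : ℕ → Ω → Ξ}
  (hξ : IsAdaptedBatches μ ν 𝓕 ξ) (hg : IsStochasticGradient ν σ f g) (hf : IsSmoothLoss L f)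

omit [IsProbabilityMeasure μ] in
include hξ hg in
theorem measurable_localIterate (k : ℕ) :
    Measurable[𝓕 k] (fun a => localIterate g ηl x (fun j => ξ j a) k) := by
  induction k with
  | zero => exact measurable_const
  | succ k ih =>
    have h1 := ih.mono (hξ.mono k.le_succ) le_rfl
    exact h1.sub ((hg.measurable.comp (h1.prodMk (hξ.adapted k))).const_smul ηl)

omit [IsProbabilityMeasure μ] in
include hξ in
theorem IsAdaptedBatches.measurable (k : ℕ) : Measurable (ξ k) :=
  (hξ.adapted k).mono (hξ.le _) le_rfl

include hξ hg hf in
theorem memLp_localNoise (k : ℕ) :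
    MemLp (fun a => localNoise f g ηl x (fun j => ξ j a) k) 2 μ :=
  hg.memLp_noise hf (hξ.le k) (measurable_localIterate hξ hg k) (hξ.measurable k) (hξ.law k)
    (hξ.indep k)

omit [IsProbabilityMeasure μ] in
include hξ hg hf in
theorem measurable_localNoise (k : ℕ) :
    Measurable[𝓕 (k + 1)] (fun a => localNoise f g ηl x (fun j => ξ j a) k) :=
  (hg.measurable_noise hf).comp
    (((measurable_localIterate hξ hg k).mono (hξ.mono k.le_succ) le_rfl).prodMk (hξ.adapted k))

omit [IsProbabilityMeasure μ] in
include hξ hg hf in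
theorem measurable_sum_localNoise (k : ℕ) :
    Measurable[𝓕 k] (fun a => ∑ j ∈ Finset.range k, localNoise f g ηl x (fun j => ξ j a) j) :=
  Finset.measurable_fun_sum _ fun j hj =>
    (measurable_localNoise hξ hg hf j).mono (hξ.mono (Finset.mem_range.1 hj)) le_rfl

include hξ hg hf in
theorem memLp_sum_localNoise (k : ℕ) :
    MemLp (fun a => ∑ j ∈ Finset.range k, localNoise f g ηl x (fun j => ξ j a) j) 2 μ :=
  memLp_finsetSum _ fun j _ => memLp_localNoise hξ hg hf j

include hξ hg hf in
theorem integral_localNoise (k : ℕ) :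
    ∫ a, localNoise f g ηl x (fun j => ξ j a) k ∂μ = 0 :=
  -- Orthogonality to the past, applied to constant vectors.
  integral_eq_zero_of_forall_integral_inner_eq_zero ℝ _
    ((memLp_localNoise hξ hg hf k).integrable one_le_two) fun c =>
      hg.integral_inner_noise hf (hξ.le k) (measurable_localIterate hξ hg k) (hξ.measurable k)
        (hξ.law k) (hξ.indep k) (W := fun _ => c) measurable_const (memLp_const c)

include hξ hg hf in
-- The cross term with the earlier noise vanishes by orthogonality, hence the factor `k` instead of
-- `k²`.
theorem integral_norm_sq_sum_localNoise_le (k : ℕ) :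
    ∫ a, ‖∑ j ∈ Finset.range k, localNoise f g ηl x (fun j => ξ j a) j‖ ^ 2 ∂μ ≤ k * σ ^ 2 := by
  induction k with
  | zero => simp
  | succ k ih =>
    have hN := memLp_sum_localNoise hξ hg hf (ηl := ηl) (x := x) k
    have hn := memLp_localNoise hξ hg hf (ηl := ηl) (x := x) k
    simp only [Finset.sum_range_succ, norm_add_sq_real]
    rw [integral_add (f := fun a => ‖∑ j ∈ Finset.range k, localNoise f g ηl x (fun j => ξ j a) j‖ ^ 2
        + 2 * inner ℝ (∑ j ∈ Finset.range k, localNoise f g ηl x (fun j => ξ j a) j)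
          (localNoise f g ηl x (fun j => ξ j a) k)) ((integrable_norm_sq hN).add ((integrable_inner hN hn).const_mul 2))
      (integrable_norm_sq hn), integral_add (integrable_norm_sq hN)
      ((integrable_inner hN hn).const_mul 2), integral_const_mul]
    have h1 : ∫ a, inner ℝ (∑ j ∈ Finset.range k, localNoise f g ηl x (fun j => ξ j a) j)
        (localNoise f g ηl x (fun j => ξ j a) k) ∂μ = 0 :=
      hg.integral_inner_noise hf (hξ.le k) (measurable_localIterate hξ hg k) (hξ.measurable k)
        (hξ.law k) (hξ.indep k) (measurable_sum_localNoise hξ hg hf k) hN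
    have h2 : ∫ a, ‖localNoise f g ηl x (fun j => ξ j a) k‖ ^ 2 ∂μ ≤ σ ^ 2 :=
      hg.integral_norm_sq_noise_le hf (hξ.le k) (measurable_localIterate hξ hg k)
        (hξ.measurable k) (hξ.law k) (hξ.indep k)
    rw [h1]
    push_cast
    linarith

theorem IsSmoothLoss.memLp_gradient (hf : IsSmoothLoss L f) {X : Ω → Param d} (hX : MemLp X 2 μ) :
    MemLp (fun a => gradient f (X a)) 2 μ := by
  have h1 : MemLp (fun a => gradient f (X a) - gradient f 0) 2 μ :=
    hX.of_le_mul (c := L) ((hf.continuous_gradient.comp_aestronglyMeasurable hX.1).sub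
      aestronglyMeasurable_const) (Filter.Eventually.of_forall fun a => by
        simpa using hf.lipschitz (X a) 0)
  exact (h1.add (memLp_const (gradient f 0))).congr_norm
    (hf.continuous_gradient.comp_aestronglyMeasurable hX.1)
    (Filter.Eventually.of_forall fun a => by simp)

include hξ hg hf in
theorem memLp_localIterate (k : ℕ) :
    MemLp (fun a => localIterate g ηl x (fun j => ξ j a) k) 2 μ := by
  induction k with
  | zero => exact memLp_const x
  | succ k ih =>
    have h := ih.sub (((memLp_localNoise hξ hg hf (ηl := ηl) (x := x) k).add
      (hf.memLp_gradient ih)).const_smul ηl)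
    refine h.congr_norm (((measurable_localIterate hξ hg (k + 1)).mono (hξ.le _) le_rfl)
      |>.aestronglyMeasurable) (Filter.Eventually.of_forall fun a => ?_)
    simp only [localIterate, localNoise, Pi.sub_apply, Pi.smul_apply, Pi.add_apply, sub_add_cancel]

end LocalSGD

/-! ### Client drift, and mean and variance of the local update. -/

section LocalDrift

variable {d : ℕ} {Ω Ξ : Type*} {mΩ : MeasurableSpace Ω} [MeasurableSpace Ξ]
  {μ : Measure Ω} [IsProbabilityMeasure μ] {ν : Measure Ξ} {L σ : ℝ} {f : Param d → ℝ}
  {g : Param d → Ξ → Param d} {ηl : ℝ} {x : Param d} {𝓕 : ℕ → MeasurableSpace Ω}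
  {ξ : ℕ → Ω → Ξ} {K : ℕ}

/-- The sum of the stochastic gradients of `K` local steps. -/
noncomputable def localUpdate (g : Param d → Ξ → Param d) (ηl : ℝ) (x : Param d) (ξ : ℕ → Ξ)
    (K : ℕ) : Param d :=
  ∑ k ∈ Finset.range K, g (localIterate g ηl x ξ k) (ξ k)

omit [MeasurableSpace Ξ] in
theorem localUpdate_eq (f : Param d → ℝ) (g : Param d → Ξ → Param d) (ηl : ℝ) (x : Param d)
    (ξ : ℕ → Ξ) (K : ℕ) : localUpdate g ηl x ξ K = ∑ j ∈ Finset.range K, localNoise f g ηl x ξ j +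
      ∑ j ∈ Finset.range K, gradient f (localIterate g ηl x ξ j) := by
  rw [← Finset.sum_add_distrib]
  exact Finset.sum_congr rfl fun k _ => by rw [localNoise, sub_add_cancel]

omit [MeasurableSpace Ξ] in
theorem localIterate_sub (g : Param d → Ξ → Param d) (ηl : ℝ) (x : Param d)
    (ξ : ℕ → Ξ) (K : ℕ) : localIterate g ηl x ξ K - x = -(ηl • localUpdate g ηl x ξ K) := by
  -- The splitting into noise and gradient is valid for any `f`, so the zero function serves here.
  rw [localIterate_eq 0, localUpdate_eq 0]
  abel

variable (hξ : IsAdaptedBatches μ ν 𝓕 ξ) (hg : IsStochasticGradient ν σ f g) (hf : IsSmoothLoss L f)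

theorem IsSmoothLoss.norm_sq_gradient_sub_le (hf : IsSmoothLoss L f) (x y : Param d) :
    ‖gradient f y - gradient f x‖ ^ 2 ≤ L ^ 2 * ‖y - x‖ ^ 2 := by
  rw [← mul_pow]
  exact pow_le_pow_left₀ (norm_nonneg _) (hf.lipschitz y x) 2

include hξ hg hf in
theorem integrable_norm_sq_localIterate_sub (k : ℕ) :
    Integrable (fun a => ‖localIterate g ηl x (fun j => ξ j a) k - x‖ ^ 2) μ :=
  integrable_norm_sq ((memLp_localIterate hξ hg hf k).sub (memLp_const x))

include hξ hg hf in
-- A recursion for the drift. The displacement is noise plus gradients; each gradient is its value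
-- at `x` plus a change of norm at most `L` times an earlier displacement, and Cauchy–Schwarz over
-- the steps gives the factors `k`.
theorem integral_norm_sq_localIterate_sub_le (k : ℕ) :
    ∫ a, ‖localIterate g ηl x (fun j => ξ j a) k - x‖ ^ 2 ∂μ ≤
      2 * ηl ^ 2 * (k * σ ^ 2 + 2 * k ^ 2 * ‖gradient f x‖ ^ 2 + 2 * L ^ 2 * k *
        ∑ j ∈ Finset.range k, ∫ a, ‖localIterate g ηl x (fun j => ξ j a) j - x‖ ^ 2 ∂μ) := by
  have hN := integrable_norm_sq (memLp_sum_localNoise hξ hg hf (ηl := ηl) (x := x) k)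
  have hy : ∀ j, Integrable (fun a => ‖localIterate g ηl x (fun j => ξ j a) j - x‖ ^ 2) μ :=
    integrable_norm_sq_localIterate_sub hξ hg hf
  have hS : Integrable (fun a => ∑ j ∈ Finset.range k,
      ‖localIterate g ηl x (fun j => ξ j a) j - x‖ ^ 2) μ := integrable_finsetSum _ fun j _ => hy j
  have hpt : ∀ a, ‖localIterate g ηl x (fun j => ξ j a) k - x‖ ^ 2 ≤
      2 * ηl ^ 2 * (‖∑ j ∈ Finset.range k, localNoise f g ηl x (fun j => ξ j a) j‖ ^ 2 +
        (2 * k ^ 2 * ‖gradient f x‖ ^ 2 + 2 * L ^ 2 * k * ∑ j ∈ Finset.range k,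
          ‖localIterate g ηl x (fun j => ξ j a) j - x‖ ^ 2)) := by
    intro a
    rw [localIterate_eq f, sub_sub_cancel_left, norm_neg, norm_smul, mul_pow, Real.norm_eq_abs,
      sq_abs]
    set N := ∑ j ∈ Finset.range k, localNoise f g ηl x (fun j => ξ j a) j
    have h1 := norm_sq_add_le N
      (∑ j ∈ Finset.range k, gradient f (localIterate g ηl x (fun j => ξ j a) j))
    have h2 := norm_sq_sum_le (Finset.range k)
      (fun j => gradient f (localIterate g ηl x (fun j => ξ j a) j))
    have h3 : ∑ j ∈ Finset.range k, ‖gradient f (localIterate g ηl x (fun j => ξ j a) j)‖ ^ 2 ≤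
        ∑ j ∈ Finset.range k, (2 * ‖gradient f x‖ ^ 2 +
          2 * L ^ 2 * ‖localIterate g ηl x (fun j => ξ j a) j - x‖ ^ 2) := by
      refine Finset.sum_le_sum fun j _ => ?_
      have h4 := norm_sq_add_le (gradient f x)
        (gradient f (localIterate g ηl x (fun j => ξ j a) j) - gradient f x)
      rw [add_sub_cancel] at h4
      linarith [hf.norm_sq_gradient_sub_le x (localIterate g ηl x (fun j => ξ j a) j)]
    rw [Finset.sum_add_distrib, Finset.sum_const, ← Finset.mul_sum, nsmul_eq_mul] at h3
    rw [Finset.card_range] at h2 h3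
    have h5 := mul_le_mul_of_nonneg_left h3 (Nat.cast_nonneg (α := ℝ) k)
    have h6 : ‖N + ∑ j ∈ Finset.range k,
        gradient f (localIterate g ηl x (fun j => ξ j a) j)‖ ^ 2 ≤
        2 * (‖N‖ ^ 2 + (2 * k ^ 2 * ‖gradient f x‖ ^ 2 + 2 * L ^ 2 * k * ∑ j ∈ Finset.range k,
          ‖localIterate g ηl x (fun j => ξ j a) j - x‖ ^ 2)) := by linarith
    linarith [mul_le_mul_of_nonneg_left h6 (sq_nonneg ηl)]
  have hS' := (integrable_const (μ := μ) (2 * k ^ 2 * ‖gradient f x‖ ^ 2)).fun_add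
    (hS.const_mul (2 * L ^ 2 * k))
  refine (integral_mono (hy k) ((hN.fun_add hS').const_mul (2 * ηl ^ 2)) hpt).trans ?_
  rw [integral_const_mul, integral_add hN hS', integral_add (integrable_const _)
    (hS.const_mul (2 * L ^ 2 * k)), integral_const_mul, integral_const_mul, integral_finsetSum _ fun j _ => hy j]
  refine mul_le_mul_of_nonneg_left ?_ (by positivity)
  have := integral_norm_sq_sum_localNoise_le hξ hg hf (ηl := ηl) (x := x) k
  simp only [integral_const, probReal_univ, one_smul]
  linarith

include hξ hg hf in
/-- The client drift. -/
theorem sum_integral_norm_sq_localIterate_sub_le (hK : 1 ≤ K)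
    (hη : 8 * ηl ^ 2 * K ^ 2 * L ^ 2 ≤ 1) :
    ∑ k ∈ Finset.range K, ∫ a, ‖localIterate g ηl x (fun j => ξ j a) k - x‖ ^ 2 ∂μ ≤
      4 * ηl ^ 2 * K * (K - 1) * (σ ^ 2 + 2 * K * ‖gradient f x‖ ^ 2) := by
  set e : ℕ → ℝ := fun k => ∫ a, ‖localIterate g ηl x (fun j => ξ j a) k - x‖ ^ 2 ∂μ
  have he : ∀ k, 0 ≤ e k := fun k => integral_nonneg fun a => sq_nonneg _
  have hK1 : (0 : ℝ) ≤ K - 1 := by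
    have : (1 : ℝ) ≤ K := by exact_mod_cast hK
    linarith
  set D := ∑ k ∈ Finset.range K, e k
  have hD : 0 ≤ D := Finset.sum_nonneg fun k _ => he k
  -- Using `k ≤ K - 1` instead of `k ≤ K` keeps the factor `K - 1`, so the drift vanishes for `K =
  -- 1`.
  have hstep : ∀ k ∈ Finset.range K, e k ≤ 2 * ηl ^ 2 * ((K - 1) * σ ^ 2 +
      2 * (K * (K - 1)) * ‖gradient f x‖ ^ 2 + 2 * L ^ 2 * K * D) := by
    intro k hk
    have hkK := Finset.mem_range.1 hk
    have h1 : (k : ℝ) ≤ K - 1 := by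
      have : ((k + 1 : ℕ) : ℝ) ≤ K := by exact_mod_cast hkK
      push_cast at this; linarith
    have h2 : (k : ℝ) ≤ K := by linarith
    have h3 : (k : ℝ) ^ 2 ≤ K * (K - 1) := by
      rw [sq]; exact mul_le_mul h2 h1 (Nat.cast_nonneg _) (Nat.cast_nonneg _)
    have h4 : ∑ j ∈ Finset.range k, e j ≤ D :=
      Finset.sum_le_sum_of_subset_of_nonneg (Finset.range_subset_range.2 hkK.le) fun j _ _ => he j
    refine (integral_norm_sq_localIterate_sub_le hξ hg hf k).trans ?_
    change 2 * ηl ^ 2 * (k * σ ^ 2 + 2 * k ^ 2 * ‖gradient f x‖ ^ 2 + 2 * L ^ 2 * k *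
        ∑ j ∈ Finset.range k, e j) ≤ _
    gcongr
  have hsum := Finset.sum_le_sum hstep
  rw [Finset.sum_const, Finset.card_range, nsmul_eq_mul] at hsum
  change D ≤ _
  change D ≤ _ at hsum
  -- Summation leaves `4 ηl² L² K² D` on the right; the step size condition makes it at most `D /
  -- 2`.
  nlinarith [mul_le_mul_of_nonneg_right hη hD]

include hξ hg hf in
theorem memLp_localUpdate :
    MemLp (fun a => localUpdate g ηl x (fun j => ξ j a) K) 2 μ := by
  simp only [localUpdate_eq f]
  exact (memLp_sum_localNoise hξ hg hf K).add
    (memLp_finsetSum _ fun j _ => hf.memLp_gradient (memLp_localIterate hξ hg hf j))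

omit [IsProbabilityMeasure μ] in
include hξ hg in
theorem measurable_localUpdate :
    Measurable[𝓕 K] (fun a => localUpdate g ηl x (fun j => ξ j a) K) :=
  Finset.measurable_fun_sum _ fun k hk =>
    hg.measurable.comp (((measurable_localIterate hξ hg k).mono
      (hξ.mono (Finset.mem_range.1 hk).le) le_rfl).prodMk
        ((hξ.adapted k).mono (hξ.mono (Finset.mem_range.1 hk)) le_rfl))

/-- Bound on the mean square deviation of the sum of the local gradients from `K ∇f(x)`. -/
noncomputable def driftBound (L ηl σ B : ℝ) (K : ℕ) : ℝ :=
  4 * L ^ 2 * ηl ^ 2 * K ^ 2 * (K - 1) * (σ ^ 2 + 2 * K * B)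

include hξ hg hf in
theorem memLp_sum_gradient_sub :
    MemLp (fun a => ∑ k ∈ Finset.range K, gradient f (localIterate g ηl x (fun j => ξ j a) k)
      - (K : ℝ) • gradient f x) 2 μ :=
  (memLp_finsetSum _ fun j _ => hf.memLp_gradient (memLp_localIterate hξ hg hf j)).sub
    (memLp_const _)

include hξ hg hf in
theorem integral_norm_sq_sum_gradient_sub_le (hK : 1 ≤ K) (hη : 8 * ηl ^ 2 * K ^ 2 * L ^ 2 ≤ 1)
    {B : ℝ} (hB : ‖gradient f x‖ ^ 2 ≤ B) :
    ∫ a, ‖∑ k ∈ Finset.range K, gradient f (localIterate g ηl x (fun j => ξ j a) k)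
      - (K : ℝ) • gradient f x‖ ^ 2 ∂μ ≤ driftBound L ηl σ B K := by
  have hpt : ∀ a, ‖∑ k ∈ Finset.range K, gradient f (localIterate g ηl x (fun j => ξ j a) k)
      - (K : ℝ) • gradient f x‖ ^ 2 ≤ K * L ^ 2 * ∑ k ∈ Finset.range K,
        ‖localIterate g ηl x (fun j => ξ j a) k - x‖ ^ 2 := by
    intro a
    have h1 : ∑ k ∈ Finset.range K, gradient f (localIterate g ηl x (fun j => ξ j a) k)
        - (K : ℝ) • gradient f x = ∑ k ∈ Finset.range K,
          (gradient f (localIterate g ηl x (fun j => ξ j a) k) - gradient f x) := by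
      rw [Finset.sum_sub_distrib, Finset.sum_const, Finset.card_range, Nat.cast_smul_eq_nsmul]
    rw [h1]
    refine (norm_sq_sum_le _ _).trans ?_
    rw [Finset.card_range, mul_assoc, Finset.mul_sum (a := L ^ 2)]
    exact mul_le_mul_of_nonneg_left
      (Finset.sum_le_sum fun k _ => hf.norm_sq_gradient_sub_le _ _) (Nat.cast_nonneg _)
  have hy : ∀ j, Integrable (fun a => ‖localIterate g ηl x (fun j => ξ j a) j - x‖ ^ 2) μ :=
    integrable_norm_sq_localIterate_sub hξ hg hf
  refine (integral_mono (integrable_norm_sq (memLp_sum_gradient_sub hξ hg hf))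
    ((integrable_finsetSum _ fun j _ => hy j).const_mul _) hpt).trans ?_
  rw [integral_const_mul, integral_finsetSum _ fun j _ => hy j]
  have hK1 : (0 : ℝ) ≤ K - 1 := by
    have : (1 : ℝ) ≤ K := by exact_mod_cast hK
    linarith
  calc _ ≤ K * L ^ 2 * (4 * ηl ^ 2 * K * (K - 1) * (σ ^ 2 + 2 * K * ‖gradient f x‖ ^ 2)) :=
        mul_le_mul_of_nonneg_left (sum_integral_norm_sq_localIterate_sub_le hξ hg hf hK hη)
          (by positivity)
    _ ≤ K * L ^ 2 * (4 * ηl ^ 2 * K * (K - 1) * (σ ^ 2 + 2 * K * B)) := by gcongr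
    _ = driftBound L ηl σ B K := by rw [driftBound]; ring

include hξ hg hf in
-- The noise has mean zero, so only the gradients along the local path contribute to the mean;
-- Jensen then reduces the claim to their mean square deviation.
theorem norm_sq_integral_localUpdate_sub_le (hK : 1 ≤ K) (hη : 8 * ηl ^ 2 * K ^ 2 * L ^ 2 ≤ 1)
    {B : ℝ} (hB : ‖gradient f x‖ ^ 2 ≤ B) :
    ‖∫ a, localUpdate g ηl x (fun j => ξ j a) K ∂μ - (K : ℝ) • gradient f x‖ ^ 2 ≤
      driftBound L ηl σ B K := by
  have hH : MemLp (fun a => ∑ k ∈ Finset.range K,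
      gradient f (localIterate g ηl x (fun j => ξ j a) k)) 2 μ :=
    memLp_finsetSum _ fun j _ => hf.memLp_gradient (memLp_localIterate hξ hg hf j)
  have hN := memLp_sum_localNoise hξ hg hf (ηl := ηl) (x := x) K
  have h1 : ∫ a, localUpdate g ηl x (fun j => ξ j a) K ∂μ =
      ∫ a, ∑ k ∈ Finset.range K, gradient f (localIterate g ηl x (fun j => ξ j a) k) ∂μ := by
    simp only [localUpdate_eq f]
    rw [integral_add (hN.integrable one_le_two) (hH.integrable one_le_two),
      integral_finsetSum _ fun j _ => (memLp_localNoise hξ hg hf j).integrable one_le_two]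
    simp [integral_localNoise hξ hg hf]
  rw [h1]
  exact (norm_sq_integral_sub_le hH _).trans
    (integral_norm_sq_sum_gradient_sub_le hξ hg hf hK hη hB)

include hξ hg hf in
-- Replacing the unknown mean by the deterministic centre `K ∇f(x)` can only increase the mean
-- square; what remains is martingale noise plus drift.
theorem variance_localUpdate_le (hK : 1 ≤ K) (hη : 8 * ηl ^ 2 * K ^ 2 * L ^ 2 ≤ 1)
    {B : ℝ} (hB : ‖gradient f x‖ ^ 2 ≤ B) :
    ∫ a, ‖localUpdate g ηl x (fun j => ξ j a) K‖ ^ 2 ∂μ -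
      ‖∫ a, localUpdate g ηl x (fun j => ξ j a) K ∂μ‖ ^ 2 ≤
      2 * K * σ ^ 2 + 2 * driftBound L ηl σ B K := by
  have hU := memLp_localUpdate hξ hg hf (ηl := ηl) (x := x) (K := K)
  have hN := integrable_norm_sq (memLp_sum_localNoise hξ hg hf (ηl := ηl) (x := x) K)
  have hR := integrable_norm_sq (memLp_sum_gradient_sub hξ hg hf (ηl := ηl) (x := x) (K := K))
  refine (integral_norm_sq_sub_le hU ((K : ℝ) • gradient f x)).trans ?_
  refine (integral_mono (integrable_norm_sq (hU.sub (memLp_const _)))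
    ((hN.const_mul 2).fun_add (hR.const_mul 2)) fun a => ?_).trans ?_
  · simp only [Pi.sub_apply]
    rw [localUpdate_eq f, add_sub_assoc]
    exact norm_sq_add_le _ _
  · rw [integral_add (hN.const_mul 2) (hR.const_mul 2), integral_const_mul, integral_const_mul]
    linarith [integral_norm_sq_sum_localNoise_le hξ hg hf (ηl := ηl) (x := x) K,
      integral_norm_sq_sum_gradient_sub_le hξ hg hf hK hη hB]

end LocalDrift

/-! ### Randomly weighted sums of independent vectors. -/

section Aggregation

variable {Ω ι E : Type*} {mΩ : MeasurableSpace Ω} {μ : Measure Ω} [IsProbabilityMeasure μ]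
  [NormedAddCommGroup E] [InnerProductSpace ℝ E] [CompleteSpace E] [MeasurableSpace E]
  [BorelSpace E] {w : ι → Ω → ℝ} {U : ι → Ω → E}
  (hw : ∀ i, MemLp (w i) 2 μ) (hU : ∀ i, MemLp (U i) 2 μ)
  (hwU : ∀ i j, IndepFun (fun a => w i a * w j a) (fun a => inner ℝ (U i a) (U j a)) μ)

omit [IsProbabilityMeasure μ] [CompleteSpace E] [MeasurableSpace E] [BorelSpace E] in
include hw hU hwU in
theorem integrable_aggregation_term (i j : ι) :
    Integrable (fun a => w i a * w j a * inner ℝ (U i a) (U j a)) μ :=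
  (hwU i j).integrable_mul ((hw i).integrable_mul (hw j)) (integrable_inner (hU i) (hU j))

variable [Fintype ι]

omit [IsProbabilityMeasure μ] [CompleteSpace E] [MeasurableSpace E] [BorelSpace E] in
include hw hU hwU in
theorem memLp_aggregation : MemLp (fun a => ∑ i, w i a • U i a) 2 μ := by
  refine memLp_finsetSum _ fun i _ => ?_
  refine memLp_two_of_norm_sq_le ((hw i).1.smul (hU i).1)
    (integrable_aggregation_term hw hU hwU i i) fun a => ?_
  rw [norm_smul, mul_pow, real_inner_self_eq_norm_sq, Real.norm_eq_abs, sq_abs, sq (w i a)]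

omit [CompleteSpace E] [MeasurableSpace E] [BorelSpace E] in
theorem norm_sq_sum_smul (w : ι → ℝ) (U : ι → E) :
    ‖∑ i, w i • U i‖ ^ 2 = ∑ i, ∑ j, w i * w j * inner ℝ (U i) (U j) := by
  rw [← real_inner_self_eq_norm_sq, sum_inner]
  refine Finset.sum_congr rfl fun i _ => ?_
  rw [inner_sum]
  refine Finset.sum_congr rfl fun j _ => ?_
  rw [real_inner_smul_left, real_inner_smul_right, mul_assoc]

include hw hU hwU in
/-- Second moment of a randomly weighted sum of independent random vectors, for weights with
`E[w_i w_j] = γ p_i p_j` when `i ≠ j`. -/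
theorem integral_norm_sq_aggregation
    (hUU : ∀ i j, i ≠ j → IndepFun (U i) (U j) μ) {p c : ι → ℝ} {γ : ℝ}
    (hoff : ∀ i j, i ≠ j → ∫ a, w i a * w j a ∂μ = γ * p i * p j)
    (hdiag : ∀ i, ∫ a, w i a * w i a ∂μ = c i) :
    ∫ a, ‖∑ i, w i a • U i a‖ ^ 2 ∂μ = γ * ‖∑ i, p i • ∫ a, U i a ∂μ‖ ^ 2 +
      ∑ i, c i * (∫ a, ‖U i a‖ ^ 2 ∂μ - ‖∫ a, U i a ∂μ‖ ^ 2) +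
      ∑ i, (c i - γ * p i ^ 2) * ‖∫ a, U i a ∂μ‖ ^ 2 := by
  classical
  -- Treat every pair as off-diagonal, which sums to `γ ‖∑ p i • E (U i)‖²`, and correct the
  -- diagonal by a variance part and a mean part.
  have hterm : ∀ i j, ∫ a, w i a * w j a * inner ℝ (U i a) (U j a) ∂μ =
      γ * (p i * p j * inner ℝ (∫ a, U i a ∂μ) (∫ a, U j a ∂μ)) +
        if i = j then c i * (∫ a, ‖U i a‖ ^ 2 ∂μ - ‖∫ a, U i a ∂μ‖ ^ 2) +
          (c i - γ * p i ^ 2) * ‖∫ a, U i a ∂μ‖ ^ 2 else 0 := by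
    intro i j
    rw [(hwU i j).integral_fun_mul_eq_mul_integral ((hw i).1.mul (hw j).1)
      ((hU i).1.inner (hU j).1)]
    split_ifs with hij
    · subst hij
      simp only [hdiag, real_inner_self_eq_norm_sq]
      ring
    · rw [hoff i j hij]
      have h : ∫ a, inner ℝ (U i a) (U j a) ∂μ = inner ℝ (∫ a, U i a ∂μ) (∫ a, U j a ∂μ) :=
        (hUU i j hij).integral_bilin ((hU i).integrable one_le_two)
        ((hU j).integrable one_le_two) (innerSL ℝ)
      rw [h]
      ring
  simp only [norm_sq_sum_smul]
  rw [integral_finsetSum _ fun i _ => integrable_finsetSum _ fun j _ =>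
    integrable_aggregation_term hw hU hwU i j]
  simp only [integral_finsetSum _ fun j _ => integrable_aggregation_term hw hU hwU _ j, hterm,
    Finset.sum_add_distrib, Finset.mul_sum, Finset.sum_ite_eq, Finset.mem_univ, if_true]
  ring

omit [MeasurableSpace E] [BorelSpace E] in
include hw hU in
theorem integral_inner_aggregation
    (hind : ∀ i (c : E), IndepFun (w i) (fun a => inner ℝ c (U i a)) μ) {p : ι → ℝ}
    (hp : ∀ i, ∫ a, w i a ∂μ = p i) (c : E) :
    ∫ a, inner ℝ c (∑ i, w i a • U i a) ∂μ = inner ℝ c (∑ i, p i • ∫ a, U i a ∂μ) := by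
  simp only [inner_sum, real_inner_smul_right]
  have hUi : ∀ i, Integrable (fun a => inner ℝ c (U i a)) μ :=
    fun i => ((hU i).integrable one_le_two).const_inner c
  have hwUi : ∀ i, Integrable (fun a => w i a * inner ℝ c (U i a)) μ :=
    fun i => (hind i c).integrable_mul ((hw i).integrable one_le_two) (hUi i)
  rw [integral_finsetSum _ fun i _ => hwUi i]
  refine Finset.sum_congr rfl fun i _ => ?_
  rw [(hind i c).integral_fun_mul_eq_mul_integral (hw i).1 (hUi i).1, hp,
    integral_inner ((hU i).integrable one_le_two)]

end Aggregation

/-! ### Second moments of the aggregation weights. -/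

section Sampling

variable {ι 𝒮 : Type*} [MeasurableSpace 𝒮] {ρ : Measure 𝒮} [IsProbabilityMeasure ρ]
  {ω : 𝒮 → ι → ℝ} {p : ι → ℝ} {α : ℝ}

theorem IsUnbiasedSampling.integral_mul_of_ne (h : IsUnbiasedSampling ρ ω p α) {i j : ι}
    (hij : i ≠ j) : ∫ s, ω s i * ω s j ∂ρ = (1 - α) * p i * p j := by
  have h1 := covariance_eq_sub (h.memLp i) (h.memLp j)
  rw [h.covariance i j hij, h.unbiased, h.unbiased] at h1
  simp only [Pi.mul_apply] at h1
  linarith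

theorem IsUnbiasedSampling.integral_mul_self (h : IsUnbiasedSampling ρ ω p α) (i : ι) :
    ∫ s, ω s i * ω s i ∂ρ = variance (fun s => ω s i) ρ + p i ^ 2 := by
  have h1 := variance_eq_sub (h.memLp i)
  rw [h.unbiased] at h1
  simp only [Pi.pow_apply, sq] at h1
  rw [h1]
  ring

end Sampling

/-! ### Independence of the sources of randomness. -/

section Randomness

variable {Ω ι 𝒮 Ξ : Type*} {mΩ : MeasurableSpace Ω} [MeasurableSpace 𝒮] [MeasurableSpace Ξ]
  {μ : Measure Ω} {ρ : Measure 𝒮} {ν : ι → Measure Ξ} {S : ℕ → Ω → 𝒮}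
  {ξ : ℕ → ι → ℕ → Ω → Ξ}

/-- The `σ`-algebra generated by the sources of randomness indexed by `A`. -/
abbrev sourceAlgebra (S : ℕ → Ω → 𝒮) (ξ : ℕ → ι → ℕ → Ω → Ξ) (A : Set (ℕ ⊕ ℕ × ι × ℕ)) :
    MeasurableSpace Ω :=
  ⨆ q ∈ A, (Sum.elim (fun t : ℕ => MeasurableSpace.comap (S t) inferInstance)
    (fun q : ℕ × ι × ℕ => MeasurableSpace.comap (ξ q.1 q.2.1 q.2.2) inferInstance)) q

theorem sourceAlgebra_mono {A B : Set (ℕ ⊕ ℕ × ι × ℕ)} (h : A ⊆ B) :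
    sourceAlgebra S ξ A ≤ sourceAlgebra S ξ B :=
  biSup_mono fun _ hq => h hq

theorem measurable_sampling_sourceAlgebra {A : Set (ℕ ⊕ ℕ × ι × ℕ)} {t : ℕ}
    (h : Sum.inl t ∈ A) : Measurable[sourceAlgebra S ξ A] (S t) :=
  measurable_iff_comap_le.2 (le_biSup (Sum.elim (fun t : ℕ => MeasurableSpace.comap (S t) _)
    (fun q : ℕ × ι × ℕ => MeasurableSpace.comap (ξ q.1 q.2.1 q.2.2) inferInstance)) h)

theorem measurable_batch_sourceAlgebra {A : Set (ℕ ⊕ ℕ × ι × ℕ)} {t : ℕ} {i : ι} {k : ℕ}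
    (h : Sum.inr (t, i, k) ∈ A) : Measurable[sourceAlgebra S ξ A] (ξ t i k) :=
  measurable_iff_comap_le.2 (le_biSup (Sum.elim (fun t : ℕ => MeasurableSpace.comap (S t) _)
    (fun q : ℕ × ι × ℕ => MeasurableSpace.comap (ξ q.1 q.2.1 q.2.2) inferInstance)) h)

variable (h : IsFedAvgRandomness μ ρ ν S ξ)

include h in
theorem IsFedAvgRandomness.source_le (q : ℕ ⊕ ℕ × ι × ℕ) :
    (Sum.elim (fun t : ℕ => MeasurableSpace.comap (S t) inferInstance)
      (fun q : ℕ × ι × ℕ => MeasurableSpace.comap (ξ q.1 q.2.1 q.2.2) inferInstance)) q ≤ mΩ := by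
  rcases q with t | q
  · exact (h.measurable_sampling t).comap_le
  · exact (h.measurable_batch _ _ _).comap_le

include h in
theorem IsFedAvgRandomness.sourceAlgebra_le (A : Set (ℕ ⊕ ℕ × ι × ℕ)) :
    sourceAlgebra S ξ A ≤ mΩ :=
  iSup₂_le fun q _ => h.source_le q

include h in
theorem IsFedAvgRandomness.indep_sourceAlgebra {A B : Set (ℕ ⊕ ℕ × ι × ℕ)} (hAB : Disjoint A B) :
    Indep (sourceAlgebra S ξ A) (sourceAlgebra S ξ B) μ :=
  indep_iSup_of_disjoint h.source_le h.indep hAB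

/-- The mini-batches of client `i` in the first `k` local steps of round `t`. -/
def batchIndices (t : ℕ) (i : ι) (k : ℕ) : Set (ℕ ⊕ ℕ × ι × ℕ) :=
  {q | ∃ j < k, q = Sum.inr (t, i, j)}

include h in
-- The starting model of the round is kept fixed, so the filtration needs only this client's earlier
-- batches in the same round.
theorem IsFedAvgRandomness.isAdaptedBatches (t : ℕ) (i : ι) :
    IsAdaptedBatches μ (ν i) (fun k => sourceAlgebra S ξ (batchIndices t i k)) (ξ t i) where
  le _ := h.sourceAlgebra_le _
  mono _ _ hkl := sourceAlgebra_mono fun _ ⟨j, hj, hq⟩ => ⟨j, hj.trans_le hkl, hq⟩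
  adapted k := measurable_batch_sourceAlgebra ⟨k, k.lt_succ_self, rfl⟩
  law k := h.law_batch t i k
  indep k := by
    refine indep_of_indep_of_le_right (h.indep_sourceAlgebra (B := {Sum.inr (t, i, k)}) ?_)
      (measurable_batch_sourceAlgebra (Set.mem_singleton _)).comap_le
    rw [Set.disjoint_singleton_right]
    rintro ⟨j, hj, hq⟩
    simp only [Sum.inr.injEq, Prod.mk.injEq, true_and] at hq
    exact hj.ne hq.symm

end Randomness

/-! ### Step size threshold and absorption of gradient terms. -/

section Arithmetic

/-- The threshold for the local step size. -/
noncomputable def stepThreshold (β L ηg α G : ℝ) (K : ℕ) : ℝ :=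
  1 / (1280 * β ^ 4 * (L * K) * (1 + ηg * (|1 - α| + |G|)))

/-- The error terms of the convergence bound. -/
noncomputable def errorTerm (L ηg ηl σ κ W A : ℝ) (K : ℕ) : ℝ :=
  L * (ηg * ηl * W * σ ^ 2) + L ^ 2 * (ηl ^ 2 * ((K : ℝ) - 1) * σ ^ 2)
    + L ^ 2 * (ηl ^ 2 * K * ((K : ℝ) - 1) * κ ^ 2)
    + L * (ηg * ηl * A * (((K : ℝ) - 1) * σ ^ 2 + K * κ ^ 2))

variable {β L ηg ηl α G σ κ W A : ℝ} {K : ℕ}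

theorem stepThreshold_pos (hβ : 1 ≤ β) (hL : 0 < L) (hηg : 0 < ηg) (hK : 1 ≤ K) :
    0 < stepThreshold β L ηg α G K := by
  have : (0 : ℝ) < K := by exact_mod_cast hK
  have : 0 < β := by linarith
  have : 0 ≤ |1 - α| + |G| := by positivity
  unfold stepThreshold
  positivity

/-- One inequality containing three smallness conditions: with `v = L ηl K`, the products of `β⁴ v`
with `1`, `ηg |1 - α|` and `ηg |G|` are each at most `1 / 1280`. -/
theorem mul_le_of_le_stepThreshold (hβ : 1 ≤ β) (hL : 0 < L) (hηg : 0 < ηg) (hK : 1 ≤ K)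
    (h : ηl ≤ stepThreshold β L ηg α G K) :
    β ^ 4 * (L * ηl * K) * (1 + ηg * (|1 - α| + |G|)) ≤ 1 / 1280 := by
  have : (0 : ℝ) < K := by exact_mod_cast hK
  have : 0 < β := by linarith
  have : 0 ≤ |1 - α| + |G| := by positivity
  rw [stepThreshold, le_div_iff₀ (by positivity)] at h
  linarith

theorem eight_mul_sq_le_of_le_stepThreshold (hβ : 1 ≤ β) (hL : 0 < L) (hηg : 0 < ηg)
    (hηl : 0 < ηl) (hK : 1 ≤ K) (h : ηl ≤ stepThreshold β L ηg α G K) :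
    8 * ηl ^ 2 * K ^ 2 * L ^ 2 ≤ 1 := by
  have hβ4 : 1 ≤ β ^ 4 := one_le_pow₀ hβ
  have hv0 : 0 ≤ L * ηl * K := by positivity
  have h1 := mul_le_of_le_stepThreshold hβ hL hηg hK h
  have h2 : 0 ≤ β ^ 4 * (L * ηl * K) * (ηg * (|1 - α| + |G|)) := by positivity
  have h3 : L * ηl * K ≤ β ^ 4 * (L * ηl * K) := le_mul_of_one_le_left hv0 hβ4
  have h4 : L * ηl * K ≤ 1 / 1280 := by linarith
  nlinarith

/-- Bound on the second moment of the aggregated update when the gradient has squared norm `γ` and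
the local gradients have squared norm at most `B`. -/
noncomputable def secondMomentBound (L ηl σ α W A B γ : ℝ) (K : ℕ) : ℝ :=
  |1 - α| * (2 * K ^ 2 * γ + 2 * driftBound L ηl σ B K) +
    (W * (2 * K * σ ^ 2) + (A + |1 - α|) * (2 * driftBound L ηl σ B K)) +
    A * (2 * K ^ 2 * B + 2 * driftBound L ηl σ B K)

theorem drift_le_errorTerm {v r B γ : ℝ} (hβ4 : 1 ≤ β ^ 4) (hγ : 0 ≤ γ) (hK1 : (1 : ℝ) ≤ K)
    (hv0 : 0 ≤ v) (hv : v = L * ηl * K) (h1 : β ^ 4 * v ≤ 1 / 1280)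
    (hB : B = 16 * β ^ 4 * γ + 8 * β ^ 2 * κ ^ 2)
    (hr : r = 4 * L ^ 2 * ηl ^ 2 * (K - 1) * (σ ^ 2 + 2 * K * B)) :
    r ≤ 4 * (L ^ 2 * (ηl ^ 2 * (K - 1) * σ ^ 2))
      + 64 * β ^ 2 * (L ^ 2 * (ηl ^ 2 * K * (K - 1) * κ ^ 2)) + γ / 8 := by
  have hP : 0 ≤ β ^ 4 * v := by positivity
  have h4 : v ≤ 1 / 1280 := (le_mul_of_one_le_left hv0 hβ4).trans h1
  have e : r = 4 * (L ^ 2 * (ηl ^ 2 * (K - 1) * σ ^ 2))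
    + 64 * β ^ 2 * (L ^ 2 * (ηl ^ 2 * K * (K - 1) * κ ^ 2))
    + 128 * (L ^ 2 * ηl ^ 2 * (K * (K - 1))) * β ^ 4 * γ := by rw [hr, hB]; ring
  have e2 : 128 * (L ^ 2 * ηl ^ 2 * (K * (K - 1))) * β ^ 4 * γ ≤ 128 * (v * (β ^ 4 * v)) * γ := by
    have : L ^ 2 * ηl ^ 2 * (K * (K - 1)) ≤ v * v := by
      rw [hv]
      have : (K : ℝ) * (K - 1) ≤ K * K := by gcongr; linarith
      nlinarith [mul_le_mul_of_nonneg_left this (show 0 ≤ L ^ 2 * ηl ^ 2 by positivity)]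
    have := mul_le_mul_of_nonneg_right this (show 0 ≤ 128 * (β ^ 4 * γ) by positivity)
    linarith
  have e3 : v * (β ^ 4 * v) ≤ 1 / 1280 * (1 / 1280) :=
    mul_le_mul h4 h1 hP (by norm_num)
  have e4 := mul_le_mul_of_nonneg_right e3 hγ
  linarith

/-- A cruder drift bound, enough where the drift is multiplied by `A`: that prefactor already
carries a power of `ηl`. -/
theorem drift_le {v r B : ℝ} (hK1 : (1 : ℝ) ≤ K) (hv0 : 0 ≤ v) (hv : v = L * ηl * K)
    (h4 : v ≤ 1 / 1280) (hB0 : 0 ≤ B)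
    (hr : r = 4 * L ^ 2 * ηl ^ 2 * (K - 1) * (σ ^ 2 + 2 * K * B)) :
    K * (2 * r) ≤ (K - 1) * σ ^ 2 + 2 * K * B := by
  have hσ : 0 ≤ σ ^ 2 := sq_nonneg σ
  have e : K * (2 * r) = 8 * L ^ 2 * ηl ^ 2 * K * ((K - 1) * σ ^ 2)
      + 8 * L ^ 2 * ηl ^ 2 * K * (K - 1) * (2 * K * B) := by rw [hr]; ring
  have e1 : 8 * L ^ 2 * ηl ^ 2 * K * K ≤ 1 := by
    have : 8 * L ^ 2 * ηl ^ 2 * K * K = 8 * (v * v) := by rw [hv]; ring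
    rw [this]
    nlinarith
  have e2 : 8 * L ^ 2 * ηl ^ 2 * K ≤ 1 :=
    (le_mul_of_one_le_right (by positivity) hK1).trans e1
  have e3 : 8 * L ^ 2 * ηl ^ 2 * K * (K - 1) ≤ 1 :=
    (mul_le_mul_of_nonneg_left (by linarith) (by positivity)).trans e1
  have e4 := mul_le_mul_of_nonneg_right e2 (mul_nonneg (show (0 : ℝ) ≤ K - 1 by linarith) hσ)
  have e5 := mul_le_mul_of_nonneg_right e3 (show 0 ≤ 2 * K * B by positivity)
  linarith

theorem heterogeneity_le_errorTerm {v r B γ : ℝ} (hL : 0 < L) (hηg : 0 < ηg) (hηl : 0 < ηl)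
    (hβ2 : 1 ≤ β ^ 2) (hγ : 0 ≤ γ) (hA : 0 ≤ A) (hK1 : (1 : ℝ) ≤ K) (hv : v = L * ηl * K)
    (h3 : β ^ 4 * v * (ηg * A) ≤ 1 / 1280) (hB : B = 16 * β ^ 4 * γ + 8 * β ^ 2 * κ ^ 2)
    (hr2 : K * (2 * r) ≤ (K - 1) * σ ^ 2 + 2 * K * B) :
    L * ηg * ηl * A * (K * (2 * r) + K * B) ≤
      24 * β ^ 2 * (L * (ηg * ηl * A * ((K - 1) * σ ^ 2 + K * κ ^ 2))) + γ / 16 := by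
  have hσ : 0 ≤ σ ^ 2 := sq_nonneg σ
  have e1 : L * ηg * ηl * A * (K * (2 * r) + K * B) ≤
      L * ηg * ηl * A * ((K - 1) * σ ^ 2 + 3 * (K * B)) := by
    refine mul_le_mul_of_nonneg_left ?_ (by positivity)
    linarith
  have e2 : L * ηg * ηl * A * ((K - 1) * σ ^ 2 + 3 * (K * B)) =
      L * ηg * ηl * A * ((K - 1) * σ ^ 2) + 24 * β ^ 2 * (L * ηg * ηl * A * (K * κ ^ 2))
        + 48 * (β ^ 4 * v * (ηg * A)) * γ := by rw [hB, hv]; ring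
  have e3 : 0 ≤ L * ηg * ηl * A * ((K - 1) * σ ^ 2) :=
    mul_nonneg (by positivity) (mul_nonneg (by linarith) hσ)
  have e4 := mul_le_mul_of_nonneg_right h3 hγ
  have e5 : L * ηg * ηl * A * ((K - 1) * σ ^ 2) ≤
      24 * β ^ 2 * (L * ηg * ηl * A * ((K - 1) * σ ^ 2)) :=
    le_mul_of_one_le_left e3 (by linarith)
  linarith

/-- After division by `ηg ηl K` the descent term is `-γ / 2`. The drift in the inner product returns
at most `γ / 16`, the heterogeneity at most `γ / 16`, and the `|1 - α|` part little more than `γ /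
1280`, so `-γ / 4` survives with room to spare. -/
theorem descent_arith {γ : ℝ} (hβ : 1 ≤ β) (hL : 0 < L) (hηg : 0 < ηg)
    (hηl : 0 < ηl) (hK : 1 ≤ K) (hle : ηl ≤ stepThreshold β L ηg α G K)
    (hW : 0 ≤ W) (hA : 0 ≤ A) (hAG : A ≤ G) (hγ : 0 ≤ γ) :
    -(ηg * ηl * (K / 2 * γ -
        driftBound L ηl σ (16 * β ^ 4 * γ + 8 * β ^ 2 * κ ^ 2) K / (2 * K))) +
      L / 2 * (ηg ^ 2 * ηl ^ 2 *
        secondMomentBound L ηl σ α W A (16 * β ^ 4 * γ + 8 * β ^ 2 * κ ^ 2) γ K) ≤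
    ηg * ηl * K * (64 * β ^ 2 * errorTerm L ηg ηl σ κ W A K - γ / 4) := by
  have hK1 : (1 : ℝ) ≤ K := by exact_mod_cast hK
  have hK0 : (0 : ℝ) < K := by linarith
  have hβ2 : 1 ≤ β ^ 2 := one_le_pow₀ hβ
  have hβ4 : 1 ≤ β ^ 4 := one_le_pow₀ hβ
  have hthr := mul_le_of_le_stepThreshold hβ hL hηg hK hle
  set B := 16 * β ^ 4 * γ + 8 * β ^ 2 * κ ^ 2 with hB
  have hB0 : 0 ≤ B := by positivity
  set c := |1 - α| with hcα
  have hc : 0 ≤ c := abs_nonneg _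
  have hAG' : A ≤ |G| := hAG.trans (le_abs_self G)
  set v := L * ηl * K with hv
  have hv0 : 0 < v := by positivity
  set r := 4 * L ^ 2 * ηl ^ 2 * (K - 1) * (σ ^ 2 + 2 * K * B) with hr
  have hr0 : 0 ≤ r := by
    have : (0 : ℝ) ≤ K - 1 := by linarith
    positivity
  have hR : driftBound L ηl σ B K = K ^ 2 * r := by rw [driftBound, hr]; ring
  clear_value B c v r
  have hP : 0 ≤ β ^ 4 * v := by positivity
  have hg0 : 0 ≤ |G| := abs_nonneg G
  have hX1 : 0 ≤ β ^ 4 * v * (ηg * c) := by positivity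
  have hX2 : 0 ≤ β ^ 4 * v * (ηg * |G|) := by positivity
  have h1 : β ^ 4 * v ≤ 1 / 1280 := by linarith
  have h2 : β ^ 4 * v * (ηg * c) ≤ 1 / 1280 := by linarith
  have h3 : β ^ 4 * v * (ηg * A) ≤ 1 / 1280 := by
    have : β ^ 4 * v * (ηg * A) ≤ β ^ 4 * v * (ηg * |G|) := by gcongr
    linarith
  have h4 : v ≤ 1 / 1280 := (le_mul_of_one_le_left hv0.le hβ4).trans h1
  have h5 : v * (ηg * c) ≤ 1 / 1280 := by
    refine le_trans ?_ h2
    rw [mul_assoc (β ^ 4)]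
    exact le_mul_of_one_le_left (by positivity) hβ4
  have hκ : 0 ≤ κ ^ 2 := sq_nonneg κ
  have hσ : 0 ≤ σ ^ 2 := sq_nonneg σ
  have hr1 := drift_le_errorTerm hβ4 hγ hK1 hv0.le hv h1 hB hr
  have hr2 := drift_le hK1 hv0.le hv h4 hB0 hr
  have hQ : L * ηg * ηl / (2 * K) * secondMomentBound L ηl σ α W A B γ K =
      v * (ηg * c) * (γ + 2 * r) + L * (ηg * ηl * W * σ ^ 2)
        + L * ηg * ηl * A * (K * (2 * r) + K * B) := by
    rw [secondMomentBound, hR, hv, ← hcα]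
    field_simp
    ring
  have hQ1 : v * (ηg * c) * (γ + 2 * r) ≤ (γ + 2 * r) / 1280 := by
    have := mul_le_mul_of_nonneg_right h5 (show 0 ≤ γ + 2 * r by positivity)
    linarith
  have hQ2 := heterogeneity_le_errorTerm hL hηg hηl hβ2 hγ hA hK1 hv h3 hB hr2
  have hT1 : 0 ≤ L * (ηg * ηl * W * σ ^ 2) := by positivity
  have hT2 : 0 ≤ L ^ 2 * (ηl ^ 2 * (K - 1) * σ ^ 2) := by
    have : (0 : ℝ) ≤ K - 1 := by linarith
    positivity
  have hT3 : 0 ≤ L * (ηg * ηl * A * ((K - 1) * σ ^ 2 + K * κ ^ 2)) := by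
    have : (0 : ℝ) ≤ K - 1 := by linarith
    positivity
  -- Since `β² ≥ 1`, the different constants before the error terms all fit under the single factor
  -- `64 β²`.
  have hfin : -(γ / 2) + r / 2 + L * ηg * ηl / (2 * K) * secondMomentBound L ηl σ α W A B γ K ≤
      64 * β ^ 2 * errorTerm L ηg ηl σ κ W A K - γ / 4 := by
    rw [hQ, errorTerm]
    have m1 := le_mul_of_one_le_left hT1 hβ2
    have m2 := le_mul_of_one_le_left hT2 hβ2
    have m3 := le_mul_of_one_le_left hT3 hβ2
    linarith
  have hscale : -(ηg * ηl * (K / 2 * γ - driftBound L ηl σ B K / (2 * K))) +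
      L / 2 * (ηg ^ 2 * ηl ^ 2 * secondMomentBound L ηl σ α W A B γ K) = ηg * ηl * K *
        (-(γ / 2) + r / 2 + L * ηg * ηl / (2 * K) * secondMomentBound L ηl σ α W A B γ K) := by
    rw [hR]
    generalize secondMomentBound L ηl σ α W A B γ K = Q
    field_simp
    ring
  rw [hscale]
  exact mul_le_mul_of_nonneg_left hfin (by positivity)

end Arithmetic

/-! ### One round from a fixed model. -/

section Round

variable {d : ℕ} {Ω ι 𝒮 Ξ : Type*} [Fintype ι] {mΩ : MeasurableSpace Ω} [MeasurableSpace 𝒮]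
  [MeasurableSpace Ξ] {μ : Measure Ω} [IsProbabilityMeasure μ] {ρ : Measure 𝒮} {ν : ι → Measure Ξ}
  {S : ℕ → Ω → 𝒮} {ξ : ℕ → ι → ℕ → Ω → Ξ} {p : ι → ℝ} {ω : 𝒮 → ι → ℝ} {F : ι → Param d → ℝ}
  {g : ι → Param d → Ξ → Param d} {L β σ κ α G ηg ηl Fmin : ℝ} {K : ℕ}

/-- One round of FedAvg. -/
noncomputable def roundMap (g : ι → Param d → Ξ → Param d) (ω : 𝒮 → ι → ℝ) (ηg ηl : ℝ) (K : ℕ)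
    (x : Param d) (z : 𝒮 × (ι → ℕ → Ξ)) : Param d :=
  x + ηg • ∑ i, ω z.1 i • (localIterate (g i) ηl x (z.2 i) K - x)

/-- The aggregated update of one round. -/
noncomputable def aggregatedUpdate (g : ι → Param d → Ξ → Param d) (ω : 𝒮 → ι → ℝ) (ηl : ℝ)
    (K : ℕ) (x : Param d) (z : 𝒮 × (ι → ℕ → Ξ)) : Param d :=
  ∑ i, ω z.1 i • localUpdate (g i) ηl x (z.2 i) K

omit [MeasurableSpace 𝒮] [MeasurableSpace Ξ] in
theorem roundMap_eq (g : ι → Param d → Ξ → Param d) (ω : 𝒮 → ι → ℝ) (ηg ηl : ℝ) (K : ℕ)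
    (x : Param d) (z : 𝒮 × (ι → ℕ → Ξ)) :
    roundMap g ω ηg ηl K x z = x + -((ηg * ηl) • aggregatedUpdate g ω ηl K x z) := by
  rw [roundMap, aggregatedUpdate, mul_smul, ← smul_neg, Finset.smul_sum (r := ηl),
    ← Finset.sum_neg_distrib]
  congr 2
  refine Finset.sum_congr rfl fun i _ => ?_
  rw [localIterate_sub, smul_neg, smul_comm]

/-- The randomness of round `t`. -/
def roundSample (S : ℕ → Ω → 𝒮) (ξ : ℕ → ι → ℕ → Ω → Ξ) (t : ℕ) (a : Ω) : 𝒮 × (ι → ℕ → Ξ) :=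
  (S t a, fun i k => ξ t i k a)

variable (hp : ∀ i, 0 ≤ p i) (hp1 : ∑ i, p i = 1) (hρ : IsUnbiasedSampling ρ ω p α)
  (hV : ∀ i, 0 ≤ variance (fun s => ω s i) ρ + α * p i ^ 2)
  (hR : IsFedAvgRandomness μ ρ ν S ξ) (hF : ∀ i, IsSmoothLoss L (F i))
  (hg : ∀ i, IsStochasticGradient (ν i) σ (F i) (g i))

omit [Fintype ι] in
include hR in
theorem IsFedAvgRandomness.isProbabilityMeasure_sampling : IsProbabilityMeasure ρ :=
  hR.law_sampling 0 ▸ Measure.isProbabilityMeasure_map (hR.measurable_sampling 0).aemeasurable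

omit [IsProbabilityMeasure μ] [Fintype ι] in
include hρ hR in
theorem memLp_weight (t : ℕ) (i : ι) : MemLp (fun a => ω (S t a) i) 2 μ := by
  have h := hρ.memLp i
  rw [← hR.law_sampling t] at h
  exact h.comp_of_map (hR.measurable_sampling t).aemeasurable

omit [IsProbabilityMeasure μ] [Fintype ι] in
include hR in
theorem integral_sampling {f : 𝒮 → ℝ} (hf : Measurable f) (t : ℕ) :
    ∫ a, f (S t a) ∂μ = ∫ s, f s ∂ρ := by
  rw [← hR.law_sampling t]
  exact (integral_map (hR.measurable_sampling t).aemeasurable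
    hf.stronglyMeasurable.aestronglyMeasurable).symm

omit [IsProbabilityMeasure μ] [Fintype ι] in
include hR hg in
theorem measurable_localUpdate_batch (t : ℕ) (i : ι) (x : Param d) :
    Measurable[sourceAlgebra S ξ (batchIndices t i K)]
      (fun a => localUpdate (g i) ηl x (fun k => ξ t i k a) K) :=
  measurable_localUpdate (hR.isAdaptedBatches t i) (hg i)

omit [IsProbabilityMeasure μ] [Fintype ι] in
include hR in
theorem indepFun_sampling_batch {𝒳 𝒴 : Type*} [MeasurableSpace 𝒳] [MeasurableSpace 𝒴] (t : ℕ)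
    {X : Ω → 𝒳} {Y : Ω → 𝒴} (hX : Measurable[sourceAlgebra S ξ {Sum.inl t}] X)
    (hY : Measurable[sourceAlgebra S ξ (Set.range Sum.inr)] Y) : IndepFun X Y μ :=
  indepFun_of_measurable (hR.indep_sourceAlgebra (by simp)) hX hY

omit [Fintype ι] in
theorem batchIndices_subset_range (t : ℕ) (i : ι) (k : ℕ) :
    batchIndices t i k ⊆ Set.range Sum.inr := by
  rintro _ ⟨j, _, rfl⟩
  exact ⟨_, rfl⟩

omit [IsProbabilityMeasure μ] [Fintype ι] in
include hρ in
theorem measurable_weight (t : ℕ) (i : ι) :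
    Measurable[sourceAlgebra S ξ {Sum.inl t}] (fun a => ω (S t a) i) :=
  (hρ.measurable i).comp (measurable_sampling_sourceAlgebra (Set.mem_singleton _))

omit [IsProbabilityMeasure μ] [Fintype ι] in
include hR hg in
theorem measurable_localUpdate_range (t : ℕ) (i : ι) (x : Param d) :
    Measurable[sourceAlgebra S ξ (Set.range Sum.inr)]
      (fun a => localUpdate (g i) ηl x (fun k => ξ t i k a) K) :=
  (measurable_localUpdate_batch hR hg t i x).mono
    (sourceAlgebra_mono (batchIndices_subset_range t i K)) le_rfl

omit [IsProbabilityMeasure μ] [Fintype ι] in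
include hρ hR hg in
theorem indepFun_weight_mul_inner (t : ℕ) (x : Param d) (i j : ι) :
    IndepFun (fun a => ω (S t a) i * ω (S t a) j)
      (fun a => inner ℝ (localUpdate (g i) ηl x (fun k => ξ t i k a) K)
        (localUpdate (g j) ηl x (fun k => ξ t j k a) K)) μ :=
  indepFun_sampling_batch hR t ((measurable_weight hρ t i).mul (measurable_weight hρ t j))
    ((measurable_localUpdate_range hR hg t i x).inner (measurable_localUpdate_range hR hg t j x))

omit [IsProbabilityMeasure μ] [Fintype ι] in
include hR hg in
theorem indepFun_localUpdate (t : ℕ) (x : Param d) {i j : ι} (hij : i ≠ j) :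
    IndepFun (fun a => localUpdate (g i) ηl x (fun k => ξ t i k a) K)
      (fun a => localUpdate (g j) ηl x (fun k => ξ t j k a) K) μ := by
  refine indepFun_of_measurable (hR.indep_sourceAlgebra ?_)
    (measurable_localUpdate_batch hR hg t i x) (measurable_localUpdate_batch hR hg t j x)
  rw [Set.disjoint_left]
  rintro _ ⟨k, _, rfl⟩ ⟨l, _, h⟩
  simp only [Sum.inr.injEq, Prod.mk.injEq] at h
  exact hij h.2.1

omit [Fintype ι] in
include hR hF hg in
theorem memLp_localUpdate_batch (t : ℕ) (i : ι) (x : Param d) :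
    MemLp (fun a => localUpdate (g i) ηl x (fun k => ξ t i k a) K) 2 μ :=
  memLp_localUpdate (hR.isAdaptedBatches t i) (hg i) (hF i)

include hρ hR hF hg in
theorem memLp_aggregatedUpdate (t : ℕ) (x : Param d) :
    MemLp (fun a => aggregatedUpdate g ω ηl K x (roundSample S ξ t a)) 2 μ :=
  memLp_aggregation (memLp_weight hρ hR t) (fun i => memLp_localUpdate_batch hR hF hg t i x)
    (indepFun_weight_mul_inner hρ hR hg t x)

theorem driftBound_nonneg {B : ℝ} (hK : 1 ≤ K) (hB : 0 ≤ B) : 0 ≤ driftBound L ηl σ B K := by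
  have : (0 : ℝ) ≤ (K : ℝ) - 1 := by
    have : (1 : ℝ) ≤ K := by exact_mod_cast hK
    linarith
  unfold driftBound
  positivity

include hp hp1 hR hF hg in
theorem norm_sq_sum_integral_localUpdate_sub_le (hK : 1 ≤ K)
    (hη : 8 * ηl ^ 2 * K ^ 2 * L ^ 2 ≤ 1) (t : ℕ) {x : Param d} {B : ℝ}
    (hB : ∀ i, ‖gradient (F i) x‖ ^ 2 ≤ B) :
    ‖∑ i, p i • ∫ a, localUpdate (g i) ηl x (fun k => ξ t i k a) K ∂μ -
      (K : ℝ) • gradient (globalLoss p F) x‖ ^ 2 ≤ driftBound L ηl σ B K := by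
  rw [gradient_globalLoss hF, Finset.smul_sum, ← Finset.sum_sub_distrib]
  calc _ = ‖∑ i, p i • (∫ a, localUpdate (g i) ηl x (fun k => ξ t i k a) K ∂μ -
        (K : ℝ) • gradient (F i) x)‖ ^ 2 := by
        simp only [smul_sub, smul_comm (K : ℝ)]
    _ ≤ ∑ i, p i * ‖∫ a, localUpdate (g i) ηl x (fun k => ξ t i k a) K ∂μ -
        (K : ℝ) • gradient (F i) x‖ ^ 2 := norm_sq_convex_sum_le hp hp1 _
    _ ≤ ∑ i, p i * driftBound L ηl σ B K := Finset.sum_le_sum fun i _ =>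
        mul_le_mul_of_nonneg_left (norm_sq_integral_localUpdate_sub_le
          (hR.isAdaptedBatches t i) (hg i) (hF i) hK hη (hB i)) (hp i)
    _ = driftBound L ηl σ B K := by rw [← Finset.sum_mul, hp1, one_mul]

theorem norm_sq_le_of_norm_sub_sq_le {E : Type*} [NormedAddCommGroup E] [InnerProductSpace ℝ E]
    {m a : E} {K : ℕ} {B R : ℝ} (h : ‖m - (K : ℝ) • a‖ ^ 2 ≤ R) (ha : ‖a‖ ^ 2 ≤ B) :
    ‖m‖ ^ 2 ≤ 2 * K ^ 2 * B + 2 * R := by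
  have h1 := norm_sq_add_le ((K : ℝ) • a) (m - (K : ℝ) • a)
  rw [add_sub_cancel, norm_smul, mul_pow, Real.norm_natCast] at h1
  linarith [mul_le_mul_of_nonneg_left ha (sq_nonneg (K : ℝ))]

include hp hp1 hρ hV hR hF hg in
-- The exact second moment formula with `γ = 1 - α`, bounded sum by sum. Nothing fixes the sign of
-- `1 - α`, hence the absolute value; the coefficients of the last sum are nonnegative by `hV`.
theorem integral_norm_sq_aggregatedUpdate_le (hK : 1 ≤ K)
    (hη : 8 * ηl ^ 2 * K ^ 2 * L ^ 2 ≤ 1) (t : ℕ) {x : Param d} {B : ℝ} (hB0 : 0 ≤ B)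
    (hB : ∀ i, ‖gradient (F i) x‖ ^ 2 ≤ B) :
    ∫ a, ‖aggregatedUpdate g ω ηl K x (roundSample S ξ t a)‖ ^ 2 ∂μ ≤
      secondMomentBound L ηl σ α (sumVar ρ ω + ∑ i, p i ^ 2) (sumVar ρ ω + α * ∑ i, p i ^ 2) B
        (‖gradient (globalLoss p F) x‖ ^ 2) K := by
  have hprob := hR.isProbabilityMeasure_sampling
  have key := integral_norm_sq_aggregation (memLp_weight hρ hR t)
    (fun i => memLp_localUpdate_batch hR hF hg t i x (ηl := ηl) (K := K))
    (indepFun_weight_mul_inner hρ hR hg t x)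
    (fun i j hij => indepFun_localUpdate hR hg t x hij) (p := p) (γ := 1 - α)
    (c := fun i => variance (fun s => ω s i) ρ + p i ^ 2)
    (fun i j hij => by
      rw [integral_sampling hR (f := fun s => ω s i * ω s j)
        ((hρ.measurable i).mul (hρ.measurable j)) t]
      exact hρ.integral_mul_of_ne hij)
    (fun i => by
      rw [integral_sampling hR (f := fun s => ω s i * ω s i)
        ((hρ.measurable i).mul (hρ.measurable i)) t]
      exact hρ.integral_mul_self i)
  change ∫ a, ‖aggregatedUpdate g ω ηl K x (roundSample S ξ t a)‖ ^ 2 ∂μ = _ at key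
  rw [key, secondMomentBound]
  set R := driftBound L ηl σ B K
  have hR0 : 0 ≤ R := driftBound_nonneg hK hB0
  have hv : ∀ i, 0 ≤ variance (fun s => ω s i) ρ + p i ^ 2 := fun i =>
    add_nonneg (variance_nonneg _ _) (sq_nonneg _)
  refine add_le_add (add_le_add ?_ ?_) ?_
  · refine (mul_le_mul_of_nonneg_right (le_abs_self (1 - α)) (sq_nonneg _)).trans ?_
    exact mul_le_mul_of_nonneg_left (norm_sq_le_of_norm_sub_sq_le
      (norm_sq_sum_integral_localUpdate_sub_le hp hp1 hR hF hg hK hη t hB) le_rfl) (abs_nonneg _)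
  · calc _ ≤ ∑ i, (variance (fun s => ω s i) ρ + p i ^ 2) * (2 * K * σ ^ 2 + 2 * R) :=
          Finset.sum_le_sum fun i _ => mul_le_mul_of_nonneg_left (variance_localUpdate_le
            (hR.isAdaptedBatches t i) (hg i) (hF i) hK hη (hB i)) (hv i)
      _ = (sumVar ρ ω + ∑ i, p i ^ 2) * (2 * K * σ ^ 2) +
          (sumVar ρ ω + ∑ i, p i ^ 2) * (2 * R) := by
          rw [← Finset.sum_mul, Finset.sum_add_distrib, sumVar, mul_add]
      _ ≤ _ := by
          have hP0 : 0 ≤ ∑ i, p i ^ 2 := Finset.sum_nonneg fun i _ => sq_nonneg _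
          have hP1 : ∑ i, p i ^ 2 ≤ 1 := by
            rw [← hp1]
            refine Finset.sum_le_sum fun i _ => pow_le_of_le_one (hp i) ?_ two_ne_zero
            rw [← hp1]
            exact Finset.single_le_sum (fun j _ => hp j) (Finset.mem_univ i)
          -- The weight `∑ E[ω i ²]` equals `A + (1 - α) ∑ p i ²`. For the drift part it is replaced
          -- by `A + |1 - α|`, which the step size threshold controls.
          have : (1 - α) * ∑ i, p i ^ 2 ≤ |1 - α| :=
            (mul_le_mul_of_nonneg_right (le_abs_self _) hP0).trans
              (mul_le_of_le_one_right (abs_nonneg _) hP1)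
          exact add_le_add le_rfl (mul_le_mul_of_nonneg_right (by linarith) (by positivity))
  · calc _ ≤ ∑ i, (variance (fun s => ω s i) ρ + α * p i ^ 2) * (2 * K ^ 2 * B + 2 * R) :=
          Finset.sum_le_sum fun i _ => by
            have e : variance (fun s => ω s i) ρ + p i ^ 2 - (1 - α) * p i ^ 2 =
                variance (fun s => ω s i) ρ + α * p i ^ 2 := by ring
            rw [e]
            exact mul_le_mul_of_nonneg_left (norm_sq_le_of_norm_sub_sq_le
              (norm_sq_integral_localUpdate_sub_le
                (hR.isAdaptedBatches t i) (hg i) (hF i) hK hη (hB i)) (hB i)) (hV i)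
      _ = _ := by rw [← Finset.sum_mul, Finset.sum_add_distrib, ← Finset.mul_sum, sumVar]

include hp hp1 hρ hR hF hg in
-- Polarization: with `M = E U`, `2 K ⟨∇F, M⟩ = K² ‖∇F‖² + ‖M‖² - ‖M - K ∇F‖²`; drop `‖M‖²` and
-- bound the last square by the drift.
theorem le_integral_inner_aggregatedUpdate (hK : 1 ≤ K)
    (hη : 8 * ηl ^ 2 * K ^ 2 * L ^ 2 ≤ 1) (t : ℕ) {x : Param d} {B : ℝ}
    (hB : ∀ i, ‖gradient (F i) x‖ ^ 2 ≤ B) :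
    K / 2 * ‖gradient (globalLoss p F) x‖ ^ 2 - driftBound L ηl σ B K / (2 * K) ≤
      ∫ a, inner ℝ (gradient (globalLoss p F) x)
        (aggregatedUpdate g ω ηl K x (roundSample S ξ t a)) ∂μ := by
  have hK0 : (0 : ℝ) < K := by exact_mod_cast hK
  have key := integral_inner_aggregation (memLp_weight hρ hR t)
    (fun i => memLp_localUpdate_batch hR hF hg t i x (ηl := ηl) (K := K))
    (fun i c => indepFun_sampling_batch hR t (measurable_weight hρ t i)
      (measurable_const.inner (measurable_localUpdate_range hR hg t i x))) (p := p)
    (fun i => by rw [integral_sampling hR (hρ.measurable i) t, hρ.unbiased])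
    (gradient (globalLoss p F) x)
  change ∫ a, inner ℝ _ (aggregatedUpdate g ω ηl K x (roundSample S ξ t a)) ∂μ = _ at key
  rw [key]
  have h1 := norm_sq_sum_integral_localUpdate_sub_le hp hp1 hR hF hg hK hη t hB (ηl := ηl)
  set M := ∑ i, p i • ∫ a, localUpdate (g i) ηl x (fun k => ξ t i k a) K ∂μ
  set γ := gradient (globalLoss p F) x
  have h2 : 0 ≤ ‖M‖ ^ 2 := sq_nonneg _
  rw [norm_sub_sq_real, real_inner_smul_right, norm_smul, mul_pow, Real.norm_natCast,
    real_inner_comm] at h1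
  rw [sub_le_iff_le_add, ← sub_le_iff_le_add', le_div_iff₀ (by positivity)]
  nlinarith

include hp hp1 hρ hV hR hF hg in
/-- Expected decrease of the federated loss in one round started at a fixed model. -/
theorem integral_globalLoss_roundMap_le (hβ : 1 ≤ β) (hL : 0 < L) (hηg : 0 < ηg) (hηl : 0 < ηl)
    (hK : 1 ≤ K) (hle : ηl ≤ stepThreshold β L ηg α G K)
    (hG : sumVar ρ ω + α * ∑ i, p i ^ 2 ≤ G) (hD : BoundedDissimilarity β κ F)
    (hmin : ∀ x, Fmin ≤ globalLoss p F x) (t : ℕ) (x : Param d) :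
    ∫ a, (globalLoss p F (roundMap g ω ηg ηl K x (roundSample S ξ t a)) - Fmin) ∂μ ≤
      globalLoss p F x - Fmin + ηg * ηl * K * (64 * β ^ 2 * errorTerm L ηg ηl σ κ
        (sumVar ρ ω + ∑ i, p i ^ 2) (sumVar ρ ω + α * ∑ i, p i ^ 2) K
        - ‖gradient (globalLoss p F) x‖ ^ 2 / 4) := by
  have hB : ∀ i, ‖gradient (F i) x‖ ^ 2 ≤
      16 * β ^ 4 * ‖gradient (globalLoss p F) x‖ ^ 2 + 8 * β ^ 2 * κ ^ 2 := fun i => by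
    rw [gradient_globalLoss hF]
    exact hD.norm_sq_gradient_le hβ hp hp1 x i
  have hη := eight_mul_sq_le_of_le_stepThreshold hβ hL hηg hηl hK hle
  have hprob := hR.isProbabilityMeasure_sampling
  have harith := descent_arith (σ := σ) (κ := κ) (W := sumVar ρ ω + ∑ i, p i ^ 2)
    hβ hL hηg hηl hK hle
    (add_nonneg (Finset.sum_nonneg fun i _ => variance_nonneg _ _)
      (Finset.sum_nonneg fun i _ => sq_nonneg _))
    (by rw [sumVar, Finset.mul_sum, ← Finset.sum_add_distrib]
        exact Finset.sum_nonneg fun i _ => hV i)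
    hG (sq_nonneg ‖gradient (globalLoss p F) x‖)
  have h2 := integral_norm_sq_aggregatedUpdate_le hp hp1 hρ hV hR hF hg hK hη t
    (by positivity) hB
  have h3 := le_integral_inner_aggregatedUpdate hp hp1 hρ hR hF hg hK hη t hB
  have hU := memLp_aggregatedUpdate hρ hR hF hg t x (ηl := ηl) (K := K)
  have hU1 : Integrable (fun a => inner ℝ (gradient (globalLoss p F) x)
      (aggregatedUpdate g ω ηl K x (roundSample S ξ t a))) μ :=
    (hU.integrable one_le_two).const_inner _
  have hU2 := integrable_norm_sq hU
  have hint : Integrable (fun a => globalLoss p F x - Fmin + (-(ηg * ηl) *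
      inner ℝ (gradient (globalLoss p F) x)
        (aggregatedUpdate g ω ηl K x (roundSample S ξ t a)) +
      L / 2 * (ηg ^ 2 * ηl ^ 2) *
        ‖aggregatedUpdate g ω ηl K x (roundSample S ξ t a)‖ ^ 2)) μ :=
    (integrable_const _).fun_add ((hU1.const_mul _).fun_add (hU2.const_mul _))
  -- Subtracting `Fmin` makes the integrand nonnegative, so only the quadratic majorant has to be
  -- integrable.
  refine (integral_mono_of_nonneg (Filter.Eventually.of_forall fun a => sub_nonneg.2 (hmin _))
    hint (Filter.Eventually.of_forall fun a => ?_)).trans ?_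
  · have := (isSmoothLoss_globalLoss hp hp1 hF).le_quadratic x
      (-((ηg * ηl) • aggregatedUpdate g ω ηl K x (roundSample S ξ t a)))
    rw [← roundMap_eq, inner_neg_right, real_inner_smul_right, norm_neg, norm_smul, mul_pow,
      Real.norm_eq_abs, sq_abs, mul_pow] at this
    simp only
    linarith
  · rw [integral_add (integrable_const _) ((hU1.const_mul _).fun_add (hU2.const_mul _)),
      integral_add (hU1.const_mul _) (hU2.const_mul _), integral_const_mul, integral_const_mul]
    simp only [integral_const, probReal_univ, one_smul]
    have h4 := mul_le_mul_of_nonneg_left h3 (show 0 ≤ ηg * ηl by positivity)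
    have h5 := mul_le_mul_of_nonneg_left h2 (show 0 ≤ L / 2 * (ηg ^ 2 * ηl ^ 2) by positivity)
    linarith

end Round

/-! ### From one round to the whole trajectory. -/

section Trajectory

variable {d : ℕ} {Ω ι 𝒮 Ξ : Type*} [Fintype ι] {mΩ : MeasurableSpace Ω} [MeasurableSpace 𝒮]
  [MeasurableSpace Ξ] {μ : Measure Ω} [IsProbabilityMeasure μ] {ρ : Measure 𝒮} {ν : ι → Measure Ξ}
  {S : ℕ → Ω → 𝒮} {ξ : ℕ → ι → ℕ → Ω → Ξ} {p : ι → ℝ} {ω : 𝒮 → ι → ℝ} {F : ι → Param d → ℝ}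
  {g : ι → Param d → Ξ → Param d} {L β σ κ α G ηg ηl Fmin : ℝ} {K : ℕ} {θ₀ : Param d}
  {θ : ℕ → Ω → Param d}

theorem measurable_localIterate_uncurry {g : Param d → Ξ → Param d}
    (hg : Measurable (Function.uncurry g)) (ηl : ℝ) (k : ℕ) :
    Measurable (fun q : Param d × (ℕ → Ξ) => localIterate g ηl q.1 q.2 k) := by
  induction k with
  | zero => exact measurable_fst
  | succ k ih =>
    exact ih.sub ((hg.comp (ih.prodMk ((measurable_pi_apply k).comp measurable_snd))).const_smul ηl)

theorem measurable_roundMap (hω : ∀ i, Measurable (fun s => ω s i))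
    (hg : ∀ i, Measurable (Function.uncurry (g i))) :
    Measurable (Function.uncurry (roundMap g ω ηg ηl K)) := by
  refine measurable_fst.add ((Finset.measurable_fun_sum _ fun i _ => ?_).const_smul ηg)
  refine ((hω i).comp (measurable_fst.comp measurable_snd)).smul (Measurable.sub ?_ measurable_fst)
  exact (measurable_localIterate_uncurry (hg i) ηl K).comp (measurable_fst.prodMk
    ((measurable_pi_apply i).comp (measurable_snd.comp measurable_snd)))

/-- The sources of randomness of round `t`. -/
def roundIndices (ι : Type*) (t : ℕ) : Set (ℕ ⊕ ℕ × ι × ℕ) :=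
  {q | Sum.elim id Prod.fst q = t}

/-- The sources of randomness of the rounds before `t`. -/
def pastIndices (ι : Type*) (t : ℕ) : Set (ℕ ⊕ ℕ × ι × ℕ) :=
  {q | Sum.elim id Prod.fst q < t}

omit [Fintype ι] in
theorem measurable_roundSample {A : Set (ℕ ⊕ ℕ × ι × ℕ)} (t : ℕ) (hA : roundIndices ι t ⊆ A) :
    Measurable[sourceAlgebra S ξ A] (roundSample S ξ t) := by
  refine (measurable_sampling_sourceAlgebra (hA ?_)).prodMk
    (@measurable_pi_lambda _ _ _ (sourceAlgebra S ξ A) _ _ fun i =>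
      @measurable_pi_lambda _ _ _ (sourceAlgebra S ξ A) _ _ fun k =>
        measurable_batch_sourceAlgebra (hA ?_)) <;> rfl

variable (hθ₀ : ∀ a, θ 0 a = θ₀)
  (hθ : ∀ t a, θ (t + 1) a = roundMap g ω ηg ηl K (θ t a) (roundSample S ξ t a))
  (hp : ∀ i, 0 ≤ p i) (hp1 : ∑ i, p i = 1) (hρ : IsUnbiasedSampling ρ ω p α)
  (hV : ∀ i, 0 ≤ variance (fun s => ω s i) ρ + α * p i ^ 2)
  (hR : IsFedAvgRandomness μ ρ ν S ξ) (hF : ∀ i, IsSmoothLoss L (F i))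
  (hg : ∀ i, IsStochasticGradient (ν i) σ (F i) (g i))

include hθ₀ hθ hρ hg in
theorem measurable_trajectory (t : ℕ) : Measurable[sourceAlgebra S ξ (pastIndices ι t)] (θ t) := by
  induction t with
  | zero => rw [funext hθ₀]; exact measurable_const
  | succ t ih =>
    rw [funext (hθ t)]
    refine (measurable_roundMap hρ.measurable fun i => (hg i).measurable).comp
      (Measurable.prodMk (ih.mono (sourceAlgebra_mono ?_) le_rfl) (measurable_roundSample t ?_))
    · exact fun q (hq : _ < t) => hq.trans t.lt_succ_self
    · exact fun q (hq : _ = t) => hq.trans_lt t.lt_succ_self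

omit [IsProbabilityMeasure μ] in
include hθ₀ hθ hρ hR hg in
theorem indepFun_trajectory (t : ℕ) : IndepFun (θ t) (roundSample S ξ t) μ := by
  refine indepFun_of_measurable (hR.indep_sourceAlgebra (A := pastIndices ι t)
    (B := roundIndices ι t) (Set.disjoint_left.2 fun q h1 h2 => ?_))
    (measurable_trajectory hθ₀ hθ hρ hg t) (measurable_roundSample t le_rfl)
  exact (ne_of_lt (show _ < t from h1)) h2

omit [IsProbabilityMeasure μ] [Fintype ι] in
include hR in
theorem IsFedAvgRandomness.measurable_roundSample (t : ℕ) : Measurable (roundSample S ξ t) :=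
  (FedAvg.measurable_roundSample (A := Set.univ) t (Set.subset_univ _)).mono
    (hR.sourceAlgebra_le _) le_rfl

/-- Serves integrability only: an affine function of `‖∇F(θ t)‖²` is integrable once `θ t` is square
integrable. -/
theorem secondMomentBound_affine {W A : ℝ} :
    ∃ c₀ c₁ : ℝ, ∀ γ, secondMomentBound L ηl σ α W A (16 * β ^ 4 * γ + 8 * β ^ 2 * κ ^ 2) γ K =
      c₀ + c₁ * γ := by
  refine ⟨secondMomentBound L ηl σ α W A (8 * β ^ 2 * κ ^ 2) 0 K,
    secondMomentBound L ηl σ α W A (16 * β ^ 4 + 8 * β ^ 2 * κ ^ 2) 1 K -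
      secondMomentBound L ηl σ α W A (8 * β ^ 2 * κ ^ 2) 0 K, fun γ => ?_⟩
  simp only [secondMomentBound, driftBound]
  ring

include hθ₀ hθ hp hp1 hρ hV hR hF hg in
-- Induction on rounds. With `θ t` frozen, the increment has second moment at most affine in `‖∇F(θ
-- t)‖²`, which is integrable because the gradient is Lipschitz. The freezing is done with lower
-- integrals, as finiteness is the point at issue.
theorem memLp_trajectory (hβ : 1 ≤ β) (hK : 1 ≤ K) (hη : 8 * ηl ^ 2 * K ^ 2 * L ^ 2 ≤ 1)
    (hD : BoundedDissimilarity β κ F) (t : ℕ) : MemLp (θ t) 2 μ := by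
  have hmeas : ∀ t, Measurable (θ t) := fun t =>
    (measurable_trajectory hθ₀ hθ hρ hg t).mono (hR.sourceAlgebra_le _) le_rfl
  induction t with
  | zero => rw [funext hθ₀]; exact memLp_const _
  | succ t ih =>
    obtain ⟨c₀, c₁, hc⟩ := secondMomentBound_affine (L := L) (ηl := ηl) (σ := σ) (α := α) (β := β)
      (κ := κ) (W := sumVar ρ ω + ∑ i, p i ^ 2) (A := sumVar ρ ω + α * ∑ i, p i ^ 2) (K := K)
    have hM := measurable_roundMap (ηg := ηg) (ηl := ηl) (K := K) hρ.measurable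
      fun i => (hg i).measurable
    have hgrad := integrable_norm_sq ((isSmoothLoss_globalLoss hp hp1 hF).memLp_gradient ih)
    have hbd : Integrable (fun a => (ηg * ηl) ^ 2 *
        (c₀ + c₁ * ‖gradient (globalLoss p F) (θ t a)‖ ^ 2)) μ :=
      ((integrable_const c₀).fun_add (hgrad.const_mul c₁)).const_mul _
    have hlin : ∫⁻ a, ENNReal.ofReal (‖θ (t + 1) a - θ t a‖ ^ 2) ∂μ ≤
        ∫⁻ a, ENNReal.ofReal ((ηg * ηl) ^ 2 *
          (c₀ + c₁ * ‖gradient (globalLoss p F) (θ t a)‖ ^ 2)) ∂μ := by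
      simp only [hθ]
      rw [lintegral_indepFun_eq (hmeas t) (hR.measurable_roundSample t)
        (indepFun_trajectory hθ₀ hθ hρ hR hg t)
        (f := fun x z => ENNReal.ofReal (‖roundMap g ω ηg ηl K x z - x‖ ^ 2))
        ((hM.sub measurable_fst).norm.pow_const 2).ennreal_ofReal]
      refine lintegral_mono fun a => ?_
      have hMa : Measurable (fun z => ENNReal.ofReal (‖roundMap g ω ηg ηl K (θ t a) z - θ t a‖ ^ 2)) :=
        (((hM.comp measurable_prodMk_left).sub measurable_const).norm.pow_const 2).ennreal_ofReal
      rw [lintegral_map hMa (hR.measurable_roundSample t)]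
      have hpt : ∀ b, ‖roundMap g ω ηg ηl K (θ t a) (roundSample S ξ t b) - θ t a‖ ^ 2 =
          (ηg * ηl) ^ 2 * ‖aggregatedUpdate g ω ηl K (θ t a) (roundSample S ξ t b)‖ ^ 2 := by
        intro b
        rw [roundMap_eq, add_sub_cancel_left, norm_neg, norm_smul, mul_pow, Real.norm_eq_abs,
          sq_abs]
      simp only [hpt]
      rw [← ofReal_integral_eq_lintegral_ofReal
        ((integrable_norm_sq (memLp_aggregatedUpdate hρ hR hF hg t (θ t a))).const_mul _)
        (Filter.Eventually.of_forall fun b => by positivity), integral_const_mul, ← hc]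
      refine ENNReal.ofReal_le_ofReal (mul_le_mul_of_nonneg_left ?_ (sq_nonneg _))
      refine integral_norm_sq_aggregatedUpdate_le hp hp1 hρ hV hR hF hg hK hη t (by positivity)
        fun i => ?_
      rw [gradient_globalLoss hF]
      exact hD.norm_sq_gradient_le hβ hp hp1 (θ t a) i
    have hdm : AEStronglyMeasurable (fun a => θ (t + 1) a - θ t a) μ :=
      ((hmeas (t + 1)).sub (hmeas t)).aestronglyMeasurable
    have hdiff : MemLp (fun a => θ (t + 1) a - θ t a) 2 μ := by
      refine (memLp_two_iff_integrable_sq_norm hdm).2 ⟨hdm.norm.pow 2, ?_⟩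
      rw [hasFiniteIntegral_iff_ofReal (Filter.Eventually.of_forall fun _ => sq_nonneg _)]
      exact hlin.trans_lt hbd.lintegral_lt_top
    exact (hdiff.add ih).congr_norm (hmeas (t + 1)).aestronglyMeasurable
      (Filter.Eventually.of_forall fun a => by simp)

/-- The shifted loss lies between `0` and the quadratic majorant at the origin. -/
theorem IsSmoothLoss.integrable_sub {f : Param d → ℝ} (hf : IsSmoothLoss L f)
    (hmin : ∀ x, Fmin ≤ f x) {X : Ω → Param d} (hX : MemLp X 2 μ) :
    Integrable (fun a => f (X a) - Fmin) μ := by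
  have hbd : Integrable (fun a => f 0 + inner ℝ (gradient f 0) (X a) + L / 2 * ‖X a‖ ^ 2 - Fmin) μ :=
    (((integrable_const _).fun_add ((hX.integrable one_le_two).const_inner _)).fun_add
      ((integrable_norm_sq hX).const_mul _)).sub (integrable_const _)
  refine hbd.mono' ((hf.differentiable.continuous.comp_aestronglyMeasurable hX.1).sub
    aestronglyMeasurable_const) (Filter.Eventually.of_forall fun a => ?_)
  rw [Real.norm_of_nonneg (sub_nonneg.2 (hmin _))]
  have := hf.le_quadratic 0 (X a)
  rw [zero_add] at this
  linarith

include hθ₀ hθ hp hp1 hρ hV hR hF hg in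
-- `θ t` depends on earlier rounds only, so the randomness of round `t` can be integrated out first,
-- with the one-round inequality applied at each value of `θ t`.
theorem integral_globalLoss_succ_le (hβ : 1 ≤ β) (hL : 0 < L) (hηg : 0 < ηg) (hηl : 0 < ηl)
    (hK : 1 ≤ K) (hle : ηl ≤ stepThreshold β L ηg α G K)
    (hG : sumVar ρ ω + α * ∑ i, p i ^ 2 ≤ G) (hD : BoundedDissimilarity β κ F)
    (hmin : ∀ x, Fmin ≤ globalLoss p F x) (t : ℕ) :
    ∫ a, (globalLoss p F (θ (t + 1) a) - Fmin) ∂μ ≤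
      ∫ a, (globalLoss p F (θ t a) - Fmin) ∂μ +
        ηg * ηl * K * (64 * β ^ 2 * errorTerm L ηg ηl σ κ
        (sumVar ρ ω + ∑ i, p i ^ 2) (sumVar ρ ω + α * ∑ i, p i ^ 2) K
        - (∫ a, ‖gradient (globalLoss p F) (θ t a)‖ ^ 2 ∂μ) / 4) := by
  have hη := eight_mul_sq_le_of_le_stepThreshold hβ hL hηg hηl hK hle
  have hLp := memLp_trajectory hθ₀ hθ hp hp1 hρ hV hR hF hg hβ hK hη hD
  have hsm := isSmoothLoss_globalLoss hp hp1 hF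
  have hint := fun t => hsm.integrable_sub hmin (hLp t)
  have hgrad := integrable_norm_sq (hsm.memLp_gradient (hLp t))
  have hM := measurable_roundMap (ηg := ηg) (ηl := ηl) (K := K) hρ.measurable
    fun i => (hg i).measurable
  have hφ : Measurable fun x => globalLoss p F x - Fmin :=
    hsm.differentiable.continuous.measurable.sub measurable_const
  have hstep := hint (t + 1)
  simp only [hθ] at hstep ⊢
  rw [integral_indepFun_eq
    ((measurable_trajectory hθ₀ hθ hρ hg t).mono (hR.sourceAlgebra_le _) le_rfl)
    (hR.measurable_roundSample t) (indepFun_trajectory hθ₀ hθ hρ hR hg t)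
    (f := fun x z => globalLoss p F (roundMap g ω ηg ηl K x z) - Fmin) (hφ.comp hM) hstep]
  set e := 64 * β ^ 2 * errorTerm L ηg ηl σ κ
        (sumVar ρ ω + ∑ i, p i ^ 2) (sumVar ρ ω + α * ∑ i, p i ^ 2) K
  have hrhs : Integrable (fun a => ηg * ηl * K *
      (e - ‖gradient (globalLoss p F) (θ t a)‖ ^ 2 / 4)) μ :=
    ((integrable_const e).sub (hgrad.div_const 4)).const_mul _
  refine (integral_mono_of_nonneg
    (Filter.Eventually.of_forall fun a => integral_nonneg fun z => sub_nonneg.2 (hmin _))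
    ((hint t).fun_add hrhs) (Filter.Eventually.of_forall fun a => ?_)).trans_eq ?_
  · have hMa : Measurable (fun z => globalLoss p F (roundMap g ω ηg ηl K (θ t a) z) - Fmin) :=
      hφ.comp (hM.comp measurable_prodMk_left)
    simp only
    rw [integral_map (hR.measurable_roundSample t).aemeasurable
      hMa.stronglyMeasurable.aestronglyMeasurable]
    exact integral_globalLoss_roundMap_le hp hp1 hρ hV hR hF hg hβ hL hηg hηl hK hle hG hD hmin t _
  · rw [integral_add (hint t) hrhs, integral_const_mul,
      integral_sub (integrable_const e) (hgrad.div_const 4), integral_div]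
    simp

include hθ₀ hθ hp hp1 hρ hV hR hF hg in
theorem avgSqGrad_le (hβ : 1 ≤ β) (hL : 0 < L) (hηg : 0 < ηg) (hηl : 0 < ηl)
    (hK : 1 ≤ K) (hle : ηl ≤ stepThreshold β L ηg α G K)
    (hG : sumVar ρ ω + α * ∑ i, p i ^ 2 ≤ G) (hD : BoundedDissimilarity β κ F)
    (hmin : ∀ x, Fmin ≤ globalLoss p F x) {T : ℕ} (hT : 1 ≤ T) :
    avgSqGrad μ (globalLoss p F) θ T ≤ 256 * β ^ 2 *
      ((globalLoss p F θ₀ - Fmin) / (ηg * ηl * K * T) + errorTerm L ηg ηl σ κ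
        (sumVar ρ ω + ∑ i, p i ^ 2) (sumVar ρ ω + α * ∑ i, p i ^ 2) K) := by
  set e := errorTerm L ηg ηl σ κ (sumVar ρ ω + ∑ i, p i ^ 2) (sumVar ρ ω + α * ∑ i, p i ^ 2) K
  set γ : ℕ → ℝ := fun t => ∫ a, ‖gradient (globalLoss p F) (θ t a)‖ ^ 2 ∂μ
  set φ : ℕ → ℝ := fun t => ∫ a, (globalLoss p F (θ t a) - Fmin) ∂μ
  have hstep : ∀ t, φ (t + 1) ≤ φ t + ηg * ηl * K * (64 * β ^ 2 * e - γ t / 4) :=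
    integral_globalLoss_succ_le hθ₀ hθ hp hp1 hρ hV hR hF hg hβ hL hηg hηl hK hle hG hD hmin
  -- The telescoped descent; `φ T ≥ 0` then allows the final loss to be discarded.
  have hsum : ∀ n : ℕ, φ n + ηg * ηl * K / 4 * ∑ t ∈ Finset.range n, γ t ≤
      φ 0 + n * (ηg * ηl * K * (64 * β ^ 2 * e)) := by
    intro n
    induction n with
    | zero => simp
    | succ n ih =>
      rw [Finset.sum_range_succ]
      push_cast
      linarith [hstep n]
  have hφ0 : φ 0 = globalLoss p F θ₀ - Fmin := by simp [φ, hθ₀]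
  have hφT : 0 ≤ φ T := integral_nonneg fun a => sub_nonneg.2 (hmin _)
  have hK0 : (0 : ℝ) < K := by exact_mod_cast hK
  have hT0 : (0 : ℝ) < T := by exact_mod_cast hT
  have hβ2 : 1 ≤ β ^ 2 := one_le_pow₀ hβ
  have h0 : 0 ≤ globalLoss p F θ₀ - Fmin := sub_nonneg.2 (hmin _)
  have hmain : ηg * ηl * K / 4 * ∑ t ∈ Finset.range T, γ t ≤
      (globalLoss p F θ₀ - Fmin) + T * (ηg * ηl * K * (64 * β ^ 2 * e)) := by
    rw [← hφ0]; linarith [hsum T]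
  have hpos : 0 < ηg * ηl * K * T := by positivity
  have h1 : avgSqGrad μ (globalLoss p F) θ T ≤
      4 * ((globalLoss p F θ₀ - Fmin) / (ηg * ηl * K * T)) + 256 * β ^ 2 * e := by
    have h2 : avgSqGrad μ (globalLoss p F) θ T =
        4 * (ηg * ηl * K / 4 * ∑ t ∈ Finset.range T, γ t) / (ηg * ηl * K * T) := by
      rw [avgSqGrad]
      field_simp
      rfl
    rw [h2, div_le_iff₀ hpos, add_mul, mul_assoc 4, div_mul_cancel₀ _ hpos.ne']
    linarith
  have h3 : 4 * ((globalLoss p F θ₀ - Fmin) / (ηg * ηl * K * T)) ≤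
      256 * β ^ 2 * ((globalLoss p F θ₀ - Fmin) / (ηg * ηl * K * T)) :=
    mul_le_mul_of_nonneg_right (by linarith) (by positivity)
  linarith

end Trajectory

end FedAvg

/-! ### The convergence theorem and its full participation cases. -/

theorem mainTheorem1 :
    ∀ β : ℝ, 1 ≤ β → ∃ C : ℝ, 0 < C ∧
    ∀ (L ηg α G : ℝ) (K : ℕ), 0 < L → 0 < ηg → 1 ≤ K → ∃ η₀ : ℝ, 0 < η₀ ∧
    ∀ (d : ℕ) (ι Ω 𝒮 Ξ : Type*) [Fintype ι] [MeasurableSpace Ω] [MeasurableSpace 𝒮]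
      [MeasurableSpace Ξ] (μ : Measure Ω) [IsProbabilityMeasure μ]
      (ρ : Measure 𝒮) (ν : ι → Measure Ξ) (S : ℕ → Ω → 𝒮) (ξ : ℕ → ι → ℕ → Ω → Ξ)
      (p : ι → ℝ) (ω : 𝒮 → ι → ℝ) (F : ι → FedAvg.Param d → ℝ)
      (g : ι → FedAvg.Param d → Ξ → FedAvg.Param d)
      (σ κ Fmin ηl : ℝ) (θ₀ : FedAvg.Param d) (θ : ℕ → Ω → FedAvg.Param d) (T : ℕ),
      -- client importances
      (∀ i, 0 ≤ p i) → ∑ i, p i = 1 →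
      -- client sampling
      FedAvg.IsUnbiasedSampling ρ ω p α →
      (∀ i, 0 ≤ variance (fun s => ω s i) ρ + α * p i ^ 2) →
      FedAvg.sumVar ρ ω + α * ∑ i, p i ^ 2 ≤ G →
      FedAvg.IsFedAvgRandomness μ ρ ν S ξ →
      -- assumptions on the losses and on the stochastic gradients
      (∀ i, FedAvg.IsSmoothLoss L (F i)) →
      (∀ i, FedAvg.IsStochasticGradient (ν i) σ (F i) (g i)) →
      FedAvg.BoundedDissimilarity β κ F →
      (∀ x, Fmin ≤ FedAvg.globalLoss p F x) →
      -- `θ` is the sequence of global models of FedAvg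
      (∀ t a, θ t a = FedAvg.globalIterate g ω ηg ηl K θ₀
        (fun s => S s a) (fun s i k => ξ s i k a) t) →
      0 < ηl → ηl ≤ η₀ → 1 ≤ T →
      (∀ t, Integrable (fun a => ‖gradient (FedAvg.globalLoss p F) (θ t a)‖ ^ 2) μ) ∧
      FedAvg.avgSqGrad μ (FedAvg.globalLoss p F) θ T ≤
        C * ((FedAvg.globalLoss p F θ₀ - Fmin) / (ηg * ηl * K * T)
          + L * (ηg * ηl * (FedAvg.sumVar ρ ω + ∑ i, p i ^ 2) * σ ^ 2)
          + L ^ 2 * (ηl ^ 2 * ((K : ℝ) - 1) * σ ^ 2)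
          + L ^ 2 * (ηl ^ 2 * K * ((K : ℝ) - 1) * κ ^ 2)
          + L * (ηg * ηl * (FedAvg.sumVar ρ ω + α * ∑ i, p i ^ 2)
              * (((K : ℝ) - 1) * σ ^ 2 + K * κ ^ 2))) ∧
      -- full participation with server learning rate `1`
      ((∀ i, ∀ᵐ s ∂ρ, ω s i = p i) → α = 0 → ηg = 1 →
        FedAvg.avgSqGrad μ (FedAvg.globalLoss p F) θ T ≤
          C * ((FedAvg.globalLoss p F θ₀ - Fmin) / (ηl * K * T)
            + L * (ηl * (∑ i, p i ^ 2) * σ ^ 2)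
            + L ^ 2 * (ηl ^ 2 * ((K : ℝ) - 1) * σ ^ 2)
            + L ^ 2 * (ηl ^ 2 * K * ((K : ℝ) - 1) * κ ^ 2)) ∧
        (ηl = Real.sqrt ((Fintype.card ι : ℝ) / (K * T)) →
          FedAvg.avgSqGrad μ (FedAvg.globalLoss p F) θ T ≤
            C * ((FedAvg.globalLoss p F θ₀ - Fmin) / Real.sqrt ((Fintype.card ι : ℝ) * K * T)
              + L * (Real.sqrt ((Fintype.card ι : ℝ) / (K * T)) * (∑ i, p i ^ 2) * σ ^ 2)
              + L ^ 2 * ((Fintype.card ι : ℝ) / T * σ ^ 2)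
              + L ^ 2 * ((Fintype.card ι : ℝ) / T * K * κ ^ 2)))) := by
  intro β hβ
  refine ⟨256 * β ^ 2, by positivity, fun L ηg α G K hL hηg hK =>
    ⟨FedAvg.stepThreshold β L ηg α G K, FedAvg.stepThreshold_pos hβ hL hηg hK, ?_⟩⟩
  intro d ι Ω 𝒮 Ξ _ _ _ _ μ _ ρ ν S ξ p ω F g σ κ Fmin ηl θ₀ θ T hp hp1 hρ hV hG hR hF hg hD hmin
    hθ hηl hle hT
  have hθ0 : ∀ a, θ 0 a = θ₀ := fun a => hθ 0 a
  have hθs : ∀ t a, θ (t + 1) a =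
      FedAvg.roundMap g ω ηg ηl K (θ t a) (FedAvg.roundSample S ξ t a) := fun t a => by
    rw [hθ (t + 1) a, hθ t a]
    rfl
  have hη := FedAvg.eight_mul_sq_le_of_le_stepThreshold hβ hL hηg hηl hK hle
  have hLp := FedAvg.memLp_trajectory hθ0 hθs hp hp1 hρ hV hR hF hg hβ hK hη hD
  have hmain := FedAvg.avgSqGrad_le hθ0 hθs hp hp1 hρ hV hR hF hg hβ hL hηg hηl hK hle hG hD hmin hT
  refine ⟨fun t => FedAvg.integrable_norm_sq
    ((FedAvg.isSmoothLoss_globalLoss hp hp1 hF).memLp_gradient (hLp t)),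
    hmain.trans_eq (by rw [FedAvg.errorTerm]; ring), fun hfull hα hηg1 => ?_⟩
  have hprob := hR.isProbabilityMeasure_sampling
  -- Constant weights have no variance; with `α = 0` the whole heterogeneity coefficient is zero,
  -- and the noise coefficient reduces to `∑ p i ²`.
  have hvar : FedAvg.sumVar ρ ω = 0 := Finset.sum_eq_zero fun i _ => by
    rw [variance_congr (hfull i)]
    simp [variance_eq_sub (memLp_const (p i))]
  have hnova : FedAvg.avgSqGrad μ (FedAvg.globalLoss p F) θ T ≤
      256 * β ^ 2 * ((FedAvg.globalLoss p F θ₀ - Fmin) / (ηl * K * T)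
        + L * (ηl * (∑ i, p i ^ 2) * σ ^ 2)
        + L ^ 2 * (ηl ^ 2 * ((K : ℝ) - 1) * σ ^ 2)
        + L ^ 2 * (ηl ^ 2 * K * ((K : ℝ) - 1) * κ ^ 2)) := by
    refine hmain.trans_eq ?_
    rw [FedAvg.errorTerm, hvar, hα, hηg1, one_mul]
    ring
  refine ⟨hnova, fun hstep => hnova.trans (mul_le_mul_of_nonneg_left ?_ (by positivity))⟩
  have hK0 : (0 : ℝ) < K := by exact_mod_cast hK
  have hT0 : (0 : ℝ) < T := by exact_mod_cast hT
  have hn : (0 : ℝ) ≤ Fintype.card ι := Nat.cast_nonneg _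
  have hsq : ηl ^ 2 = (Fintype.card ι : ℝ) / (K * T) := by
    rw [hstep, Real.sq_sqrt (by positivity)]
  have hden : ηl * K * T = Real.sqrt ((Fintype.card ι : ℝ) * K * T) := by
    rw [eq_comm, Real.sqrt_eq_iff_eq_sq (by positivity) (by positivity), mul_pow, mul_pow, hsq]
    field_simp
  -- This step size gives `ηl² K = n / T`; the bounds for both drift terms follow from `K - 1 ≤ K`.
  have hσ : ηl ^ 2 * ((K : ℝ) - 1) * σ ^ 2 ≤ (Fintype.card ι : ℝ) / T * σ ^ 2 := by
    have : ηl ^ 2 * K = (Fintype.card ι : ℝ) / T := by rw [hsq]; field_simp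
    rw [← this]
    gcongr
    linarith
  have hκ : ηl ^ 2 * K * ((K : ℝ) - 1) * κ ^ 2 ≤ (Fintype.card ι : ℝ) / T * K * κ ^ 2 := by
    have : ηl ^ 2 * K = (Fintype.card ι : ℝ) / T := by rw [hsq]; field_simp
    rw [← this]
    gcongr
    linarith
  rw [hden, ← hstep]
  gcongr
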